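/- Let $\mathbb K$ be an algebraically closed field of characteristic not $2$ and let $n\ge 2$. A first-class $n$-Lie superalgebra is a $\mathbb Z_2$-graded vector space $\mathfrak g=\mathfrak g_{\bar0}\oplus\mathfrak g_{\bar1}$ with an $n$-linear bracket such that, for homogeneous elements, $|[x_1,\dots,x_n]|=|x_1|+\dots+|x_n|$, $[\dots,x_i,x_{i+1},\dots]=-(-1)^{|x_i||x_{i+1}|}[\dots,x_{i+1},x_i,\dots]$, and $$[x_1,\dots,x_{n-1},[y_1,\dots,y_n]]=\sum_{i=1}^n(-1)^{(|x_1|+\dots+|x_{n-1}|)(|y_1|+\dots+|y_{i-1}|)}[y_1,\dots,[x_1,\dots,x_{n-1},y_i],\dots,y_n].$$ It is nilpotent if $\mathfrak g^k=0$ for some $k$, where $\mathfrak g^0=\mathfrak g$ and $\mathfrak g^{j+1}=[\mathfrak g^j,\mathfrak g,\dots,\mathfrak g]$. It is metric if it carries a nondegenerate bilinear form $\langle\,,\rangle$ that is consistent ($\langle x,y\rangle=0$ if $|x|\ne|y|$), supersymmetric ($\langle x,y\rangle=(-1)^{|x||y|}\langle y,x\rangle$) and invariant ($\langle[x_1,\dots,x_{n-1},y],z\rangle=-(-1)^{(|x_1|+\dots+|x_{n-1}|)|y|}\langle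 y,[x_1,\dots,x_{n-1},z]\rangle$). A graded ideal is a graded subspace $I$ with $[I,\mathfrak g,\dots,\mathfrak g]\subseteq I$; a subspace $U$ is isotropic if $\langle U,U\rangle=0$, and abelian if $[U,U,\mathfrak g,\dots,\mathfrak g]=0$. An isometry is an isomorphism of graded $n$-ary algebras (of degree $0$) that preserves the forms. For a first-class $n$-Lie superalgebra $\mathfrak h$, the coadjoint action on $\mathfrak h^*$ is $\mathrm{ad}^*(x_1,\dots,x_{n-1})(f)(z)=-(-1)^{(|x_1|+\dots+|x_{n-1}|)|f|}f([x_1,\dots,x_{n-1},z])$. For an $n$-linear map $\theta:\mathfrak h^n\to\mathfrak h^*$ of degree $0$ with the same skew-supersymmetry as the bracket, put on $\mathfrak h\oplus\mathfrak h^*$ the bracket $$[x_1+f_1,\dots,x_n+f_n]_\theta=[x_1,\dots,x_n]+\theta(x_1,\dots,x_n)+\sum_{i=1}^n(-1)^{n-i}(-1)^{|x_i|(|x_{i+1}|+\dots+|x_n|)}\mathrm{ad}^*(x_1,\dots,\widehat{x_i},\dots,x_n)f_i$$ and the form $\langle x+f,y+g\rangle_\theta=f(y)+(-1)^{|x||y|}g(x)$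 (for homogeneous $x+f$, that is $|x|=|f|$, etc.). If $\theta$ is a $1$-supercocycle, that is, with $|x|=|x_1|+\dots+|x_{n-1}|$ and with $[y_1,\dots,f,\dots,y_n]$, $f\in\mathfrak h^*$, denoting the bracket for $\theta=0$, $$\theta(x_1,\dots,x_{n-1},[y_1,\dots,y_n])+\mathrm{ad}^*(x_1,\dots,x_{n-1})\theta(y_1,\dots,y_n)=\sum_{i=1}^n(-1)^{|x|(|y_1|+\dots+|y_{i-1}|)}\big(\theta(y_1,\dots,[x_1,\dots,x_{n-1},y_i],\dots,y_n)+[y_1,\dots,\theta(x_1,\dots,x_{n-1},y_i),\dots,y_n]\big),$$ and if $\theta(x_1,\dots,x_{n-1},y)(z)+(-1)^{|y||z|}\theta(x_1,\dots,x_{n-1},z)(y)=0$, then the metric first-class $n$-Lie superalgebra $(\mathfrak h\oplus\mathfrak h^*,[\,,\dots,]_\theta,\langle\,,\rangle_\theta)$ is called the $T^*$-extension of $\mathfrak h$ by $\theta$. **Theorem.** Let $(\mathfrak g,\langle\,,\rangle)$ be a nilpotent metric first-class $n$-Lie superalgebra of finite dimension $m$ over $\mathbb K$, and let $J$ be an isotropic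 graded ideal of $\mathfrak g$. Then there is a graded ideal $I\supseteq J$ of dimension $\lfloor m/2\rfloor$ which is maximal among the isotropic graded ideals of $\mathfrak g$ and has the following property. If $m$ is even, then $\mathfrak g$ is isometric to some $T^*$-extension of $\mathfrak g/I$. If $m$ is odd, then $I^\perp$ is abelian, and $\mathfrak g$ is isometric to a graded ideal of codimension $1$ in some $T^*$-extension of $\mathfrak g/I$, on which the form of the $T^*$-extension is nondegenerate. In both cases the $T^*$-extension is again a metric first-class $n$-Lie superalgebra. -/

import Mathlib

open Module

/-- The sign `(-1) ^ a` for a parity `a` in `ℤ/2`. -/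
def superSign (K : Type*) [Field K] (a : ZMod 2) : K := if a = 0 then 1 else -1

/-- A `ℤ/2`-graded vector space `V = V_0 ⊕ V_1` together with an `(n + 1)`-ary multilinear bracket.
Throughout, `n` is the arity minus one, so that a fundamental object is a tuple indexed by `Fin n`. -/
structure NSuperalgebra (K : Type*) [Field K] (V : Type*) [AddCommGroup V] [Module K V]
    (n : ℕ) where
  /-- The subspace of homogeneous elements of a given degree. -/
  grade : ZMod 2 → Submodule K V
  isCompl : ∀ a, IsCompl (grade a) (grade (a + 1))
  /-- The bracket `[x_0, ..., x_n]`. -/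
  bracket : MultilinearMap K (fun _ : Fin (n + 1) => V) V

namespace NSuperalgebra

section Basic

variable {K : Type*} [Field K] {V : Type*} [AddCommGroup V] [Module K V] {n : ℕ}

/-- The inner map `z ↦ [x_0, ..., x_{n-1}, z]` of a fundamental object. -/
noncomputable def ad (A : NSuperalgebra K V n) (x : Fin n → V) : V →ₗ[K] V :=
  A.bracket.curryRight x

/-- The homogeneous component of degree `a`. -/
noncomputable def proj (A : NSuperalgebra K V n) (a : ZMod 2) : V →ₗ[K] V :=
  (A.grade a).projection (A.grade (a + 1)) (A.isCompl a)

/-- The tuple `x` consists of homogeneous elements, of the degrees `a`. -/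
def Homogeneous {ι : Type*} (A : NSuperalgebra K V n) (a : ι → ZMod 2) (x : ι → V) : Prop :=
  ∀ i, x i ∈ A.grade (a i)

/-- The laws of an `(n + 1)`-Lie superalgebra of parity `0`. -/
structure IsFirstClassNLie (A : NSuperalgebra K V n) : Prop where
  bracket_mem : ∀ (a : Fin (n + 1) → ZMod 2) (x : Fin (n + 1) → V), A.Homogeneous a x →
    A.bracket x ∈ A.grade (∑ i, a i)
  skew : ∀ (a : Fin (n + 1) → ZMod 2) (x : Fin (n + 1) → V), A.Homogeneous a x →
    ∀ i : Fin n, A.bracket x =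
      -(superSign K (a i.castSucc * a i.succ) •
        A.bracket (x ∘ Equiv.swap i.castSucc i.succ))
  fundamental : ∀ (a : Fin n → ZMod 2) (x : Fin n → V) (b : Fin (n + 1) → ZMod 2)
    (y : Fin (n + 1) → V), A.Homogeneous a x → A.Homogeneous b y →
    A.ad x (A.bracket y) =
      ∑ i, superSign K ((∑ j, a j) * ∑ j ∈ Finset.Iio i, b j) •
        A.bracket (Function.update y i (A.ad x (y i)))

/-- A consistent, supersymmetric, invariant, nondegenerate bilinear form. -/
structure IsMetric (A : NSuperalgebra K V n) (B : LinearMap.BilinForm K V) : Prop where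
  nondegenerate : ∀ x, (∀ y, B x y = 0) → x = 0
  invariant : ∀ (a : Fin n → ZMod 2) (b c : ZMod 2) (x : Fin n → V) (y z : V),
    A.Homogeneous a x → y ∈ A.grade b → z ∈ A.grade c →
    B (A.ad x y) z = -(superSign K ((∑ i, a i) * b) * B y (A.ad x z))
  supersymmetric : ∀ (a b : ZMod 2) (x y : V), x ∈ A.grade a → y ∈ A.grade b →
    B x y = superSign K (a * b) * B y x
  consistent : ∀ (a b : ZMod 2) (x y : V), x ∈ A.grade a → y ∈ A.grade b → a ≠ b → B x y = 0

/-- The descending series `g^0 = g`, `g^{m+1} = [g^m, g, ..., g]`. -/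
def lowerSeries (A : NSuperalgebra K V n) : ℕ → Submodule K V
  | 0 => ⊤
  | m + 1 => Submodule.span K {v | ∃ x : Fin (n + 1) → V, x 0 ∈ A.lowerSeries m ∧ A.bracket x = v}

/-- Nilpotency: the descending series reaches zero. -/
def IsNilpotent (A : NSuperalgebra K V n) : Prop := ∃ k, A.lowerSeries k = ⊥

/-- A graded ideal: a subspace containing the homogeneous components of its elements and every
bracket with an entry in it. (For graded subspaces of an `n`-Lie superalgebra it does not matter
which entry, by skew-supersymmetry.) -/
structure IsGradedIdeal (A : NSuperalgebra K V n) (I : Submodule K V) : Prop where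
  graded : ∀ x ∈ I, ∀ a, A.proj a x ∈ I
  ideal : ∀ (x : Fin (n + 1) → V) (i : Fin (n + 1)), x i ∈ I → A.bracket x ∈ I

/-- `[U, U, g, ..., g] = 0`, where the two entries from `U` may stand in any two places. -/
def IsAbelian (A : NSuperalgebra K V n) (U : Submodule K V) : Prop :=
  ∀ (x : Fin (n + 1) → V) (i j : Fin (n + 1)), i ≠ j → x i ∈ U → x j ∈ U → A.bracket x = 0

/-- The bilinear form vanishes on `U`. -/
def IsIsotropic (B : LinearMap.BilinForm K V) (U : Submodule K V) : Prop :=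
  ∀ x ∈ U, ∀ y ∈ U, B x y = 0

/-- An injective linear map of degree `0` that preserves the brackets and the bilinear forms, that
is, an isometry onto its range. -/
structure IsIsometry {V' : Type*} [AddCommGroup V'] [Module K V'] (A : NSuperalgebra K V n)
    (B : LinearMap.BilinForm K V) (A' : NSuperalgebra K V' n) (B' : LinearMap.BilinForm K V')
    (φ : V →ₗ[K] V') : Prop where
  injective : Function.Injective φ
  map_grade : ∀ a, ∀ x ∈ A.grade a, φ x ∈ A'.grade a
  map_bracket : ∀ x : Fin (n + 1) → V, φ (A.bracket x) = A'.bracket (fun i => φ (x i))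
  map_form : ∀ x y, B' (φ x) (φ y) = B x y

theorem proj_of_mem (A : NSuperalgebra K V n) {a : ZMod 2} {x : V} (hx : x ∈ A.grade a) :
    A.proj a x = x :=
  Submodule.projection_apply_left (A.isCompl a) ⟨x, hx⟩

theorem proj_of_mem_ne (A : NSuperalgebra K V n) {a b : ZMod 2} {x : V} (hx : x ∈ A.grade b)
    (hab : a ≠ b) : A.proj a x = 0 := by
  have key : ∀ a b : ZMod 2, a ≠ b → b = a + 1 := by decide
  have h := key a b hab
  subst h
  exact (Submodule.projection_apply_eq_zero_iff (A.isCompl a)).2 hx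

theorem proj_mem (A : NSuperalgebra K V n) (a : ZMod 2) (x : V) : A.proj a x ∈ A.grade a :=
  Submodule.projection_apply_mem (A.isCompl a) x

end Basic

section Quotient

variable {K : Type*} [Field K] {V : Type*} [AddCommGroup V] [Module K V] {n : ℕ}

theorem quotient_isCompl (A : NSuperalgebra K V n) {I : Submodule K V} (hI : A.IsGradedIdeal I)
    (a : ZMod 2) : IsCompl ((A.grade a).map I.mkQ) ((A.grade (a + 1)).map I.mkQ) := by
  constructor
  · rw [Submodule.disjoint_def]
    rintro _ ⟨x, hx, rfl⟩ ⟨y, hy, hxy⟩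
    have h1 : y - x ∈ I := by
      rw [← Submodule.ker_mkQ I, LinearMap.mem_ker, map_sub, hxy, sub_self]
    have h2 := hI.graded _ h1 a
    rw [map_sub, A.proj_of_mem hx, A.proj_of_mem_ne hy (by simp), zero_sub,
      neg_mem_iff] at h2
    simpa using h2
  · rw [codisjoint_iff, ← Submodule.map_sup, (A.isCompl a).sup_eq_top, Submodule.map_top,
      Submodule.range_mkQ]

/-- A linear section of the projection onto `V ⧸ I`. -/
noncomputable def quotSection (I : Submodule K V) : (V ⧸ I) →ₗ[K] V :=
  (I.mkQ.exists_rightInverse_of_surjective I.range_mkQ).choose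

theorem mkQ_quotSection (I : Submodule K V) (x : V ⧸ I) : I.mkQ (quotSection I x) = x :=
  LinearMap.congr_fun (I.mkQ.exists_rightInverse_of_surjective I.range_mkQ).choose_spec x

/-- The quotient `g / I` by a graded ideal. The bracket is computed on representatives; by
`quotient_bracket_mk` their choice is immaterial. -/
noncomputable def quotient (A : NSuperalgebra K V n) (I : Submodule K V)
    (hI : A.IsGradedIdeal I) : NSuperalgebra K (V ⧸ I) n where
  grade a := (A.grade a).map I.mkQ
  isCompl := A.quotient_isCompl hI
  bracket := (I.mkQ.compMultilinearMap A.bracket).compLinearMap (fun _ => quotSection I)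

theorem quotient_bracket_mk (A : NSuperalgebra K V n) {I : Submodule K V}
    (hI : A.IsGradedIdeal I) (x : Fin (n + 1) → V) :
    (A.quotient I hI).bracket (fun i => I.mkQ (x i)) = I.mkQ (A.bracket x) := by
  have key : ∀ (s : Finset (Fin (n + 1))) (y : Fin (n + 1) → V),
      (∀ i ∈ s, y i - x i ∈ I) → (∀ i ∉ s, y i = x i) →
      I.mkQ (A.bracket y) = I.mkQ (A.bracket x) := by
    intro s
    induction s using Finset.induction_on with
    | empty =>
      intro y _ h
      rw [show y = x from funext fun i => h i (by simp)]
    | insert k s hk ih =>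
      intro y h1 h2
      rw [← ih (Function.update y k (x k)) ?_ ?_, ← sub_eq_zero, ← map_sub]
      · have : A.bracket y - A.bracket (Function.update y k (x k)) =
            A.bracket (Function.update y k (y k - x k)) := by
          rw [MultilinearMap.map_update_sub, Function.update_eq_self]
        rw [this, ← LinearMap.mem_ker, Submodule.ker_mkQ]
        have h3 : Function.update y k (y k - x k) k ∈ I := by
          rw [Function.update_self]
          exact h1 k (by simp)
        exact hI.ideal _ k h3
      · intro i hi
        have : i ≠ k := fun h => hk (h ▸ hi)
        simpa [this] using h1 i (by simp [hi])
      · intro i hi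
        by_cases hik : i = k
        · subst hik; simp
        · simpa [hik] using h2 i (by simp [hik, hi])
  refine key Finset.univ _ (fun i _ => ?_) (by simp)
  have h : I.mkQ (quotSection I (I.mkQ (x i)) - x i) = 0 := by
    rw [map_sub, mkQ_quotSection, sub_self]
  rwa [← LinearMap.mem_ker, Submodule.ker_mkQ] at h

end Quotient

section TStar

variable {K : Type*} [Field K] {V : Type*} [AddCommGroup V] [Module K V] {n : ℕ}

/-- The functionals of degree `a`: those that vanish on the other homogeneous component. -/
def dualGrade (A : NSuperalgebra K V n) (a : ZMod 2) : Submodule K (Dual K V) :=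
  (A.grade (a + 1)).dualAnnihilator

/-- The coadjoint action `ad^*(x)(f) = -(-1)^{|x||f|} f([x, ·])` of a fundamental object `x` of
degree `p` on a functional `f` of degree `q`. -/
noncomputable def coad (A : NSuperalgebra K V n) (p : ZMod 2) (x : Fin n → V) (q : ZMod 2)
    (f : Dual K V) : Dual K V :=
  -(superSign K (p * q) • (f ∘ₗ A.ad x))

/-- The value of `[x_0, ..., f, ..., x_n]` with the functional `f` at place `i`, obtained by moving
`f` to the last place and applying the coadjoint action; `a j` is the degree of `x j` for `j ≠ i`,
and `a i` is the degree of `f` (the entry `x i` is not used). -/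
noncomputable def coadAt (A : NSuperalgebra K V n) (i : Fin (n + 1)) (a : Fin (n + 1) → ZMod 2)
    (x : Fin (n + 1) → V) (f : Dual K V) : Dual K V :=
  ((-1 : K) ^ (n - (i : ℕ)) * superSign K (a i * ∑ j ∈ Finset.Ioi i, a j)) •
    A.coad (∑ j : Fin n, a (i.succAbove j)) (fun j => x (i.succAbove j)) (a i) f

/-- `coadAt`, with fixed signs, as a multilinear map. -/
noncomputable def coadAtMultilinear (A : NSuperalgebra K V n) (i : Fin (n + 1))
    (a : Fin (n + 1) → ZMod 2) :
    MultilinearMap K (fun _ : Fin (n + 1) => V × Dual K V) (Dual K V) :=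
  MultilinearMap.mk'
    (fun w => A.coadAt i a (fun j => (w j).1) (w i).2)
    (by
      intro w j u v
      rcases Fin.eq_self_or_eq_succAbove i j with rfl | ⟨k, rfl⟩
      · ext z
        simp [coadAt, coad, Fin.succAbove_ne]
        ring
      · have h : ∀ u : V × Dual K V,
            (fun l => (Function.update w (i.succAbove k) u (i.succAbove l)).1) =
              Function.update (fun l => (w (i.succAbove l)).1) k u.1 := by
          intro u
          ext l
          by_cases hl : l = k
          · subst hl; simp
          · simp [hl]
        ext z
        simp [coadAt, coad, h, ad, (Fin.succAbove_ne i k).symm]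
        ring)
    (by
      intro w j c u
      rcases Fin.eq_self_or_eq_succAbove i j with rfl | ⟨k, rfl⟩
      · ext z
        simp [coadAt, coad, Fin.succAbove_ne]
        ring
      · have h : ∀ u : V × Dual K V,
            (fun l => (Function.update w (i.succAbove k) u (i.succAbove l)).1) =
              Function.update (fun l => (w (i.succAbove l)).1) k u.1 := by
          intro u
          ext l
          by_cases hl : l = k
          · subst hl; simp
          · simp [hl]
        ext z
        simp [coadAt, coad, h, ad, (Fin.succAbove_ne i k).symm]
        ring)

theorem tstar_isCompl (A : NSuperalgebra K V n) (a : ZMod 2) :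
    IsCompl ((A.grade a).prod (A.dualGrade a)) ((A.grade (a + 1)).prod (A.dualGrade (a + 1))) := by
  have h : a + 1 + 1 = a := by revert a; decide
  constructor
  · rw [disjoint_iff, Submodule.prod_inf_prod, (A.isCompl a).inf_eq_bot, dualGrade, dualGrade, h,
      ← Submodule.dualAnnihilator_sup_eq, sup_comm, (A.isCompl a).sup_eq_top,
      Submodule.dualAnnihilator_top, Submodule.prod_bot]
  · rw [codisjoint_iff, Submodule.prod_sup_prod, (A.isCompl a).sup_eq_top, dualGrade, dualGrade, h,
      ← Subspace.dualAnnihilator_inf_eq, inf_comm, (A.isCompl a).inf_eq_bot,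
      Submodule.dualAnnihilator_bot, Submodule.prod_top]

theorem dual_apply_proj_of_mem (A : NSuperalgebra K V n) {a : ZMod 2} {f : Dual K V}
    (hf : f ∈ A.dualGrade a) (x : V) : f (A.proj a x) = f x := by
  have h := (A.isCompl a).sup_eq_top
  obtain ⟨y, hy, z, hz, rfl⟩ := Submodule.mem_sup.1 (h ▸ Submodule.mem_top : x ∈ _)
  rw [map_add, A.proj_of_mem hy, A.proj_of_mem_ne hz (by simp), add_zero, map_add,
    (Submodule.mem_dualAnnihilator f).1 hf z hz, add_zero]

theorem dual_apply_proj_of_mem_ne (A : NSuperalgebra K V n) {a b : ZMod 2} {f : Dual K V}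
    (hf : f ∈ A.dualGrade b) (hab : a ≠ b) (x : V) : f (A.proj a x) = 0 := by
  have key : ∀ a b : ZMod 2, a ≠ b → a = b + 1 := by decide
  have h := key a b hab
  subst h
  exact (Submodule.mem_dualAnnihilator f).1 hf _ (A.proj_mem _ x)

/-- The superalgebra `g ⊕ g^*` with the bracket
`[x_0 + f_0, ..., x_n + f_n]_θ = [x_0, ..., x_n] + θ(x_0, ..., x_n) + ∑ i, [x_0, ..., f_i, ..., x_n]`
for homogeneous `x_i + f_i` with `|x_i| = |f_i|`, extended multilinearly: the last sum is taken over
all the ways `a` to choose a homogeneous component in each entry. -/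
noncomputable def tstar (A : NSuperalgebra K V n)
    (θ : MultilinearMap K (fun _ : Fin (n + 1) => V) (Dual K V)) :
    NSuperalgebra K (V × Dual K V) n where
  grade a := (A.grade a).prod (A.dualGrade a)
  isCompl := A.tstar_isCompl
  bracket :=
    (LinearMap.inl K V (Dual K V)).compMultilinearMap
        (A.bracket.compLinearMap fun _ => LinearMap.fst K V (Dual K V)) +
      (LinearMap.inr K V (Dual K V)).compMultilinearMap
        ((θ.compLinearMap fun _ => LinearMap.fst K V (Dual K V)) +
          ∑ a : Fin (n + 1) → ZMod 2, ∑ i,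
            (A.coadAtMultilinear i a).compLinearMap
              fun j => (A.proj (a j)).prodMap (A.proj (a j)).dualMap)

theorem tstar_bracket_of_homogeneous (A : NSuperalgebra K V n)
    (θ : MultilinearMap K (fun _ : Fin (n + 1) => V) (Dual K V)) (a : Fin (n + 1) → ZMod 2)
    (w : Fin (n + 1) → V × Dual K V) (hw : (A.tstar θ).Homogeneous a w) :
    (A.tstar θ).bracket w =
      (A.bracket fun i => (w i).1,
        θ (fun i => (w i).1) + ∑ i, A.coadAt i a (fun j => (w j).1) (w i).2) := by
  have hz : ∀ c : Fin (n + 1) → ZMod 2, ∀ j,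
      ((A.proj (c j)).prodMap (A.proj (c j)).dualMap) (w j) = if c j = a j then w j else 0 := by
    intro c j
    obtain ⟨h1, h2⟩ := hw j
    split_ifs with h
    · rw [h]
      refine Prod.ext (A.proj_of_mem h1) (LinearMap.ext fun x => ?_)
      exact A.dual_apply_proj_of_mem h2 x
    · refine Prod.ext (A.proj_of_mem_ne h1 h) (LinearMap.ext fun x => ?_)
      exact A.dual_apply_proj_of_mem_ne h2 h x
  have hs : ∑ c : Fin (n + 1) → ZMod 2, ∑ i, (A.coadAtMultilinear i c)
      (fun j => ((A.proj (c j)).prodMap (A.proj (c j)).dualMap) (w j)) =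
        ∑ i, A.coadAt i a (fun j => (w j).1) (w i).2 := by
    rw [Finset.sum_eq_single a]
    · refine Finset.sum_congr rfl fun i _ => ?_
      simp only [hz, if_true]
      rfl
    · intro c _ hc
      obtain ⟨j, hj⟩ := Function.ne_iff.1 hc
      refine Finset.sum_eq_zero fun i _ => MultilinearMap.map_coord_zero _ j ?_
      rw [hz, if_neg hj]
    · simp
  rw [← hs]
  simp only [tstar, add_apply, LinearMap.compMultilinearMap_apply,
    MultilinearMap.compLinearMap_apply, sum_apply, LinearMap.inl_apply,
    LinearMap.inr_apply, LinearMap.fst_apply, Prod.mk_add_mk, add_zero, zero_add]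

/-- The bilinear form on `g ⊕ g^*` with `⟨x + f, y + g⟩ = f(y) + (-1)^{|x||y|} g(x)` for homogeneous
`x + f` and `y + g`, extended bilinearly. -/
noncomputable def tstarForm (A : NSuperalgebra K V n) : LinearMap.BilinForm K (V × Dual K V) :=
  LinearMap.mk₂ K
    (fun u v => u.2 v.1 + ∑ a, ∑ b, superSign K (a * b) * v.2 (A.proj b (A.proj a u.1)))
    (by intro u u' v; simp [mul_add, Finset.sum_add_distrib]; ring)
    (by intro c u v; simp [Finset.mul_sum, mul_add, mul_left_comm])
    (by intro u v v'; simp [mul_add, Finset.sum_add_distrib]; ring)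
    (by intro c u v; simp [Finset.mul_sum, mul_add, mul_left_comm])

theorem tstarForm_of_homogeneous (A : NSuperalgebra K V n) (a b : ZMod 2)
    (u v : V × Dual K V) (hu : u.1 ∈ A.grade a) (hv : v.2 ∈ A.dualGrade b) :
    A.tstarForm u v = u.2 v.1 + superSign K (a * b) * v.2 u.1 := by
  simp only [tstarForm, LinearMap.mk₂_apply]
  rw [Finset.sum_eq_single a, Finset.sum_eq_single b, A.proj_of_mem hu,
    A.dual_apply_proj_of_mem hv]
  · intro c _ hc
    rw [A.dual_apply_proj_of_mem_ne hv hc, mul_zero]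
  · simp
  · intro c _ hc
    simp [A.proj_of_mem_ne hu hc]
  · simp

/-- `θ` is an even `1`-supercocycle of `g` with values in the coadjoint module `g^*`, and it
satisfies the supercyclic identity. The field `cocycle` is `(δθ)(x, (y_0, ..., y_{n-1}), y_n) = 0`. -/
structure IsSupercyclicCocycle (A : NSuperalgebra K V n)
    (θ : MultilinearMap K (fun _ : Fin (n + 1) => V) (Dual K V)) : Prop where
  degree : ∀ (a : Fin (n + 1) → ZMod 2) (x : Fin (n + 1) → V), A.Homogeneous a x →
    θ x ∈ A.dualGrade (∑ i, a i)
  skew : ∀ (a : Fin (n + 1) → ZMod 2) (x : Fin (n + 1) → V), A.Homogeneous a x →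
    ∀ i : Fin n, θ x =
      -(superSign K (a i.castSucc * a i.succ) • θ (x ∘ Equiv.swap i.castSucc i.succ))
  cocycle : ∀ (a : Fin n → ZMod 2) (x : Fin n → V) (b : Fin (n + 1) → ZMod 2)
    (y : Fin (n + 1) → V), A.Homogeneous a x → A.Homogeneous b y →
    θ (Fin.snoc x (A.bracket y)) + A.coad (∑ j, a j) x (∑ j, b j) (θ y)
      - ∑ i, superSign K ((∑ j, a j) * ∑ j ∈ Finset.Iio i, b j) •
          θ (Function.update y i (A.ad x (y i)))
      - ∑ i, superSign K ((∑ j, a j) * ∑ j ∈ Finset.Iio i, b j) •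
          A.coadAt i (Function.update b i ((∑ j, a j) + b i)) y (θ (Fin.snoc x (y i))) = 0
  supercyclic : ∀ (a : Fin n → ZMod 2) (b c : ZMod 2) (x : Fin n → V) (y z : V),
    A.Homogeneous a x → y ∈ A.grade b → z ∈ A.grade c →
    θ (Fin.snoc x y) z + superSign K (b * c) * θ (Fin.snoc x z) y = 0

end TStar

end NSuperalgebra

/-! Take `I ⊇ J` maximal among the isotropic graded ideals. Nilpotency gives `[I^⊥, g, ..., g] ⊆ I`
(`IsMetric.orthogonal_le_centralizerMod`). Indeed, let `Z` be the set of all `w` in `I^⊥` with `[w,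
g, ..., g] ⊆ I`. Homogeneous elements of `Z ∩ Z^⊥` can be added to `I`, so they already lie in it.
Climbing the descending series from `0` then gives `Z^⊥ ⊆ I`, and dually `I^⊥ ⊆ Z`.

Hence every homogeneous isotropic vector of `I^⊥` lies in `I`. Odd vectors are isotropic since the
characteristic is not `2`, and over an algebraically closed field the even part of `I^⊥ / I` has
dimension at most `1`. So `I^⊥` is `I` or `I ⊕ K e` with `e` even and anisotropic, according to the
parity of `dim g` (`IsMetric.orthogonal_of_maximal`).

If `I^⊥ = I`, there is a graded isotropic section `s` of the projection `π` to `g / I`, and `v ↦ (π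
v, ⟨v, s ·⟩)` is an isometry onto the extension by `θ = ⟨[s ·, ..., s ·], s ·⟩`. The cocycle and
supercyclic identities need no separate verification: the laws of `g` are carried over by the
bijection, and the identities are their components in the dual (`isSupercyclicCocycle_of_tstar`).

If `I^⊥ = I ⊕ K e`, add to `g` an orthogonal central line on which the form is `-⟨e, e⟩`. Then `I +
K (e, 1)` is a Lagrangian ideal of `g ⊕ K` with quotient `g / I`, so the first case applies to `g ⊕
K`, in which `g` is an ideal of codimension `1`. -/

namespace NSuperalgebra

/-! ### Koszul signs -/

section Sign

variable {K : Type*} [Field K]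

theorem zmod_two_cases (a : ZMod 2) : a = 0 ∨ a = 1 := by
  revert a; decide

theorem superSign_add_left (a b c : ZMod 2) :
    superSign K ((a + b) * c) = superSign K (a * c) * superSign K (b * c) := by
  have h : (1 + 1 : ZMod 2) = 0 := by decide
  rcases zmod_two_cases a with rfl | rfl <;> rcases zmod_two_cases b with rfl | rfl <;>
    rcases zmod_two_cases c with rfl | rfl <;> simp [superSign, h]

theorem superSign_add_right (a b c : ZMod 2) :
    superSign K (a * (b + c)) = superSign K (a * b) * superSign K (a * c) := by
  rw [mul_comm, superSign_add_left, mul_comm b, mul_comm c]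

theorem superSign_mul_self (a : ZMod 2) : superSign K a * superSign K a = 1 := by
  unfold superSign; split_ifs <;> simp

@[simp]
theorem superSign_zero : superSign K 0 = 1 := by simp [superSign]

end Sign

/-! ### Multilinear maps on spanning sets and modulo subspaces -/

section MultilinearMaps

variable {K : Type*} [Field K] {V W : Type*} [AddCommGroup V] [Module K V] [AddCommGroup W]
  [Module K W]

/-- Multilinear maps that agree on the tuples from a spanning set are equal. -/
theorem multilinear_ext_of_span {ι : Type*} [Fintype ι] {S : Set V}
    (hS : Submodule.span K S = ⊤) (f g : MultilinearMap K (fun _ : ι => V) W)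
    (h : ∀ x : ι → V, (∀ i, x i ∈ S) → f x = g x) : f = g := by
  classical
  -- `s` is the set of places where the entry is arbitrary; the span induction frees one place at a
  -- time.
  have key : ∀ (s : Finset ι) (x : ι → V), (∀ i ∉ s, x i ∈ S) → f x = g x := by
    intro s
    induction s using Finset.induction_on with
    | empty => exact fun x hx => h x fun i => hx i (by simp)
    | insert k s hk ih =>
      intro x hx
      have hu : ∀ u, f (Function.update x k u) = g (Function.update x k u) := by
        intro u
        have hu : u ∈ Submodule.span K S := hS ▸ Submodule.mem_top
        induction hu using Submodule.span_induction with
        | mem u hu =>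
          refine ih _ fun i hi => ?_
          by_cases hik : i = k
          · subst hik; simpa using hu
          · simpa [hik] using hx i (by simp [hi, hik])
        | zero => simp
        | add u v _ _ hu hv => rw [f.map_update_add, g.map_update_add, hu, hv]
        | smul c u _ hu => rw [f.map_update_smul, g.map_update_smul, hu]
      simpa using hu (x k)
  exact MultilinearMap.ext fun x => key Finset.univ x (by simp)

/-- A multilinear map which sends the tuples with an entry in `U` to `T` factors modulo `T`
through the quotient by `U`. -/
theorem multilinear_sub_mem {ι : Type*} [Fintype ι] (f : MultilinearMap K (fun _ : ι => V) W)
    {U : Submodule K V} {T : Submodule K W} (h : ∀ x i, x i ∈ U → f x ∈ T) (x y : ι → V)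
    (hxy : ∀ i, x i - y i ∈ U) : f x - f y ∈ T := by
  classical
  -- The entries of `x` are replaced by those of `y` one by one; each replacement changes `f` by a
  -- value with an entry in `U`.
  have key : ∀ (s : Finset ι) (x : ι → V), (∀ i ∈ s, x i - y i ∈ U) → (∀ i ∉ s, x i = y i) →
      f x - f y ∈ T := by
    intro s
    induction s using Finset.induction_on with
    | empty =>
      intro x _ hx
      rw [show x = y from funext fun i => hx i (by simp), sub_self]
      exact T.zero_mem
    | insert k s hk ih =>
      intro x h1 h2
      have h3 := ih (Function.update x k (y k)) (fun i hi => ?_) (fun i hi => ?_)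
      · have h4 : f x - f (Function.update x k (y k)) =
            f (Function.update x k (x k - y k)) := by
          rw [f.map_update_sub, Function.update_eq_self]
        have h5 : f (Function.update x k (x k - y k)) ∈ T :=
          h _ k (by simpa using h1 k (by simp))
        rw [← h4] at h5
        simpa using T.add_mem h5 h3
      · have : i ≠ k := fun h => hk (h ▸ hi)
        simpa [this] using h1 i (by simp [hi])
      · by_cases hik : i = k
        · subst hik; simp
        · simpa [hik] using h2 i (by simp [hik, hi])
  exact key Finset.univ x (fun i _ => hxy i) (by simp)

end MultilinearMaps

/-! ### Homogeneous components and permuting entries of the bracket -/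

section Grading

variable {K : Type*} [Field K] {V W : Type*} [AddCommGroup V] [Module K V] [AddCommGroup W]
  [Module K W] {n : ℕ}

theorem sum_proj (A : NSuperalgebra K V n) (x : V) : ∑ a, A.proj a x = x := by
  have h := (A.isCompl 0).sup_eq_top
  obtain ⟨y, hy, z, hz, rfl⟩ := Submodule.mem_sup.1 (h ▸ Submodule.mem_top : x ∈ _)
  have hu : (Finset.univ : Finset (ZMod 2)) = {0, 1} := by decide
  rw [zero_add] at hz
  rw [hu, Finset.sum_pair (by decide), map_add, map_add, A.proj_of_mem hy, A.proj_of_mem hz,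
    A.proj_of_mem_ne hy (by decide), A.proj_of_mem_ne hz (by decide)]
  simp

theorem homogeneous_proj (A : NSuperalgebra K V n) {ι : Type*} (a : ι → ZMod 2) (x : ι → V) :
    A.Homogeneous a fun i => A.proj (a i) (x i) := fun i => A.proj_mem (a i) (x i)

theorem multilinear_eq_sum_proj (A : NSuperalgebra K V n) {ι : Type*} [Fintype ι] [DecidableEq ι]
    (f : MultilinearMap K (fun _ : ι => V) W) (x : ι → V) :
    f x = ∑ a : ι → ZMod 2, f fun i => A.proj (a i) (x i) := by
  rw [← f.map_sum fun i a => A.proj a (x i)]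
  simp only [sum_proj]

/-- The subspace contains the homogeneous components of its elements. -/
def IsGradedSubspace (A : NSuperalgebra K V n) (U : Submodule K V) : Prop :=
  ∀ x ∈ U, ∀ a, A.proj a x ∈ U

theorem proj_proj (A : NSuperalgebra K V n) (a b : ZMod 2) (x : V) :
    A.proj a (A.proj b x) = if a = b then A.proj b x else 0 := by
  split_ifs with h
  · rw [h, A.proj_of_mem (A.proj_mem b x)]
  · exact A.proj_of_mem_ne (A.proj_mem b x) h

theorem ad_apply (A : NSuperalgebra K V n) (x : Fin n → V) (z : V) :
    A.ad x z = A.bracket (Fin.snoc x z) := rfl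

theorem bracket_eq_ad_last (A : NSuperalgebra K V n) (x : Fin (n + 1) → V) :
    A.bracket x = A.ad (fun j => x ((Fin.last n).succAbove j)) (x (Fin.last n)) := by
  rw [ad_apply]
  congr 1
  simp only [Fin.succAbove_last]
  exact (Fin.snoc_init_self x).symm

theorem Homogeneous.comp {A : NSuperalgebra K V n} {ι κ : Type*} {a : ι → ZMod 2} {x : ι → V}
    (h : A.Homogeneous a x) (e : κ → ι) : A.Homogeneous (a ∘ e) (x ∘ e) := fun i => h (e i)

theorem swap_succ_succAbove {n : ℕ} (i j : Fin n) :
    Equiv.swap i.castSucc i.succ (i.succ.succAbove j) = i.castSucc.succAbove j := by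
  simp only [Fin.succAbove, Equiv.swap_apply_def, apply_ite Fin.val, Fin.ext_iff, Fin.lt_def,
    Fin.val_castSucc, Fin.val_succ]
  split_ifs <;> omega

theorem sum_Ioi_castSucc {n : ℕ} (a : Fin (n + 1) → ZMod 2) (i : Fin n) :
    ∑ j ∈ Finset.Ioi i.castSucc, a j = a i.succ + ∑ j ∈ Finset.Ioi i.succ, a j := by
  rw [← Finset.sum_insert (by simp)]
  refine Finset.sum_congr (Finset.ext fun j => ?_) fun _ _ => rfl
  simp only [Finset.mem_Ioi, Finset.mem_insert, Fin.lt_def, Fin.ext_iff, Fin.val_castSucc,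
    Fin.val_succ]
  omega

/-- Moving an entry of the bracket to the last place. -/
theorem IsFirstClassNLie.bracket_eq_ad {A : NSuperalgebra K V n} (hA : A.IsFirstClassNLie)
    (k : Fin (n + 1)) (a : Fin (n + 1) → ZMod 2) (x : Fin (n + 1) → V)
    (hx : A.Homogeneous a x) :
    A.bracket x = ((-1 : K) ^ (n - (k : ℕ)) * superSign K (a k * ∑ j ∈ Finset.Ioi k, a j)) •
      A.ad (fun j => x (k.succAbove j)) (x k) := by
  -- Each adjacent transposition carries the entry one place to the right, at the cost of one factor
  -- `-1` and one Koszul sign.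
  induction k using Fin.reverseInduction generalizing a x with
  | last =>
    rw [bracket_eq_ad_last, Finset.Ioi_eq_empty.2 fun b _ => Fin.le_last b]
    simp
  | cast i ih =>
    rw [hA.skew a x hx i, ih _ _ (hx.comp (Equiv.swap i.castSucc i.succ)), sum_Ioi_castSucc,
      superSign_add_right]
    simp only [Function.comp_apply, swap_succ_succAbove, Equiv.swap_apply_right]
    have h1 : ∑ j ∈ Finset.Ioi i.succ, a (Equiv.swap i.castSucc i.succ j) =
        ∑ j ∈ Finset.Ioi i.succ, a j := by
      refine Finset.sum_congr rfl fun j hj => ?_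
      rw [Finset.mem_Ioi] at hj
      rw [Equiv.swap_apply_of_ne_of_ne (ne_of_gt (lt_trans (Fin.castSucc_lt_succ) hj))
        (ne_of_gt hj)]
    have h2 : n - (i.castSucc : ℕ) = (n - (i.succ : ℕ)) + 1 := by
      have := i.2
      simp only [Fin.val_castSucc, Fin.val_succ]
      omega
    rw [h1, h2, pow_succ, smul_smul, ← neg_smul]
    congr 1
    ring

/-- If the brackets with first entry in a graded subspace `W` lie in `T`, then so do the brackets
with any entry in `W`. -/
theorem IsFirstClassNLie.bracket_mem_of_first {A : NSuperalgebra K V n}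
    (hA : A.IsFirstClassNLie) {W T : Submodule K V} (hW : A.IsGradedSubspace W)
    (h : ∀ x, x 0 ∈ W → A.bracket x ∈ T) (x : Fin (n + 1) → V) (i : Fin (n + 1))
    (hx : x i ∈ W) : A.bracket x ∈ T := by
  induction i using Fin.induction generalizing x with
  | zero => exact h x hx
  | succ i ih =>
    -- Skew-supersymmetry is available for homogeneous entries only; since `W` is graded, the
    -- components of the entry stay in `W`.
    rw [A.multilinear_eq_sum_proj]
    refine Submodule.sum_mem _ fun a _ => ?_
    rw [hA.skew a _ (A.homogeneous_proj a x) i]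
    refine T.neg_mem (T.smul_mem _ (ih _ ?_))
    simpa using hW _ hx _

theorem IsFirstClassNLie.ad_mem {A : NSuperalgebra K V n} (hA : A.IsFirstClassNLie)
    {a : Fin n → ZMod 2} {b : ZMod 2} {x : Fin n → V} {z : V} (hx : A.Homogeneous a x)
    (hz : z ∈ A.grade b) : A.ad x z ∈ A.grade ((∑ i, a i) + b) := by
  have := hA.bracket_mem (Fin.snoc a b) (Fin.snoc x z) (fun i => by
    refine Fin.lastCases ?_ (fun i => ?_) i
    · simpa using hz
    · simpa using hx i)
  simpa [Fin.sum_univ_castSucc, ad_apply] using this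

end Grading

/-! ### Orthogonality for a metric form -/

section Metric

variable {K : Type*} [Field K] {V : Type*} [AddCommGroup V] [Module K V] {n : ℕ}
  {A : NSuperalgebra K V n} {B : LinearMap.BilinForm K V}

theorem IsMetric.proj_left (hB : A.IsMetric B) (a : ZMod 2) (x y : V) :
    B (A.proj a x) y = B (A.proj a x) (A.proj a y) := by
  conv_lhs => rw [← A.sum_proj y, map_sum]
  refine Finset.sum_eq_single a (fun b _ hb => ?_) (by simp)
  exact hB.consistent a b _ _ (A.proj_mem a x) (A.proj_mem b y) hb.symm

theorem IsMetric.proj_right (hB : A.IsMetric B) (a : ZMod 2) (x y : V) :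
    B x (A.proj a y) = B (A.proj a x) (A.proj a y) := by
  conv_lhs => rw [← A.sum_proj x, map_sum, LinearMap.sum_apply]
  refine Finset.sum_eq_single a (fun b _ hb => ?_) (by simp)
  exact hB.consistent b a _ _ (A.proj_mem b x) (A.proj_mem a y) hb

/-- Supersymmetry compares the two orders only on homogeneous vectors. A graded `U` can be tested
component by component, so left and right orthogonality to it agree. -/
theorem IsMetric.eq_zero_comm (hB : A.IsMetric B) {U : Submodule K V}
    (hU : A.IsGradedSubspace U) (x : V) :
    (∀ u ∈ U, B u x = 0) ↔ ∀ u ∈ U, B x u = 0 := by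
  constructor
  · intro h u hu
    rw [← A.sum_proj u, map_sum]
    refine Finset.sum_eq_zero fun a _ => ?_
    rw [hB.proj_right, hB.supersymmetric a a _ _ (A.proj_mem a x) (A.proj_mem a u),
      ← hB.proj_left, h _ (hU u hu a), mul_zero]
  · intro h u hu
    rw [← A.sum_proj u, map_sum, LinearMap.sum_apply]
    refine Finset.sum_eq_zero fun a _ => ?_
    rw [hB.proj_left, hB.supersymmetric a a _ _ (A.proj_mem a u) (A.proj_mem a x),
      ← hB.proj_right, h _ (hU u hu a), mul_zero]

theorem IsMetric.mem_orthogonal_iff (hB : A.IsMetric B) {U : Submodule K V}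
    (hU : A.IsGradedSubspace U) {x : V} : x ∈ B.orthogonal U ↔ ∀ u ∈ U, B x u = 0 :=
  hB.eq_zero_comm hU x

theorem IsMetric.nondegenerate_form (hB : A.IsMetric B) : B.Nondegenerate := by
  refine ⟨hB.nondegenerate, fun x hx => hB.nondegenerate x fun y => ?_⟩
  exact (hB.eq_zero_comm (U := ⊤) (fun _ _ _ => trivial) x).1 (fun u _ => hx u) y trivial

theorem IsMetric.isGradedSubspace_orthogonal (hB : A.IsMetric B) {U : Submodule K V}
    (hU : A.IsGradedSubspace U) : A.IsGradedSubspace (B.orthogonal U) := by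
  intro x hx a u hu
  change B u (A.proj a x) = 0
  rw [hB.proj_right, ← hB.proj_left]
  exact hx _ (hU u hu a)

theorem IsMetric.orthogonal_orthogonal [FiniteDimensional K V] (hB : A.IsMetric B)
    {U : Submodule K V} (hU : A.IsGradedSubspace U) : B.orthogonal (B.orthogonal U) = U := by
  refine (Submodule.eq_of_le_of_finrank_le (fun x hx => ?_) ?_).symm
  · intro y hy
    exact (hB.mem_orthogonal_iff hU).1 hy x hx
  · rw [LinearMap.BilinForm.finrank_orthogonal hB.nondegenerate_form,
      LinearMap.BilinForm.finrank_orthogonal hB.nondegenerate_form]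
    have := U.finrank_le
    omega

/-- Invariance of the form in an arbitrary entry of the bracket. -/
theorem IsMetric.exists_form_bracket (hA : A.IsFirstClassNLie) (hB : A.IsMetric B)
    (i : Fin (n + 1)) {a : Fin (n + 1) → ZMod 2} {b : ZMod 2} {x : Fin (n + 1) → V} {z : V}
    (hx : A.Homogeneous a x) (hz : z ∈ A.grade b) :
    ∃ c : K, B (A.bracket x) z = c * B (x i) (A.ad (fun j => x (i.succAbove j)) z) := by
  rw [hA.bracket_eq_ad i a x hx, map_smul, LinearMap.smul_apply,
    hB.invariant (fun j => a (i.succAbove j)) (a i) b _ _ _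
      (fun j => hx (i.succAbove j)) (hx i) hz]
  exact ⟨_, by rw [smul_eq_mul, ← neg_mul, ← mul_assoc]⟩

/-- A bracket is orthogonal to `z` if, after passing to homogeneous components, its entry at place
`i` is orthogonal to the bracket of the other entries with `z`. -/
theorem IsMetric.form_bracket_eq_zero (hA : A.IsFirstClassNLie) (hB : A.IsMetric B)
    {z : V} (i : Fin (n + 1)) (x : Fin (n + 1) → V)
    (h : ∀ (a : Fin (n + 1) → ZMod 2) (b : ZMod 2), B (A.proj (a i) (x i))
      (A.ad (fun j => A.proj (a (i.succAbove j)) (x (i.succAbove j))) (A.proj b z)) = 0) :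
    B (A.bracket x) z = 0 := by
  rw [A.multilinear_eq_sum_proj, map_sum, LinearMap.sum_apply]
  refine Finset.sum_eq_zero fun a _ => ?_
  rw [← A.sum_proj z, map_sum]
  refine Finset.sum_eq_zero fun b _ => ?_
  obtain ⟨c, hc⟩ := hB.exists_form_bracket hA i (A.homogeneous_proj a x) (A.proj_mem b z)
  rw [hc, h a b, mul_zero]

/-- By invariance, pairing a bracket with `u ∈ U` amounts to pairing its entry from `U^⊥` with a
bracket that contains `u`, and the latter lies in `U`. -/
theorem IsMetric.isGradedIdeal_orthogonal (hA : A.IsFirstClassNLie) (hB : A.IsMetric B)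
    {U : Submodule K V} (hU : A.IsGradedIdeal U) : A.IsGradedIdeal (B.orthogonal U) := by
  refine ⟨hB.isGradedSubspace_orthogonal hU.graded, fun x i hx => ?_⟩
  refine (hB.mem_orthogonal_iff hU.graded).2 fun u hu => ?_
  refine hB.form_bracket_eq_zero hA i x fun a b => ?_
  refine (hB.mem_orthogonal_iff hU.graded).1
    (hB.isGradedSubspace_orthogonal hU.graded _ hx _) _ ?_
  exact hU.ideal _ (Fin.last n) (by simpa using hU.graded u hu b)

end Metric

/-! ### Maximal isotropic graded ideals -/

section MaximalIsotropic

variable {K : Type*} [Field K] {V : Type*} [AddCommGroup V] [Module K V] {n : ℕ}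
  {A : NSuperalgebra K V n} {B : LinearMap.BilinForm K V}

theorem IsFirstClassNLie.isGradedSubspace_lowerSeries (hA : A.IsFirstClassNLie) (k : ℕ) :
    A.IsGradedSubspace (A.lowerSeries k) := by
  induction k with
  | zero => exact fun _ _ _ => trivial
  | succ k ih =>
    intro v hv a
    induction hv using Submodule.span_induction with
    | mem v hv =>
      obtain ⟨x, hx, rfl⟩ := hv
      rw [A.multilinear_eq_sum_proj A.bracket x, map_sum]
      refine Submodule.sum_mem _ fun c _ => ?_
      have hc := hA.bracket_mem c _ (A.homogeneous_proj c x)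
      by_cases hac : a = ∑ i, c i
      · rw [hac, A.proj_of_mem hc]
        exact Submodule.subset_span ⟨_, ih _ hx _, rfl⟩
      · rw [A.proj_of_mem_ne hc hac]
        exact Submodule.zero_mem _
    | zero => simp
    | add u v _ _ hu hv => rw [map_add]; exact Submodule.add_mem _ hu hv
    | smul c u _ hu => rw [map_smul]; exact Submodule.smul_mem _ c hu

/-- The elements `w` with `[w, g, ..., g] ⊆ I`. -/
def centralizerMod (A : NSuperalgebra K V n) (I : Submodule K V) : Submodule K V :=
  ⨅ (x : Fin (n + 1) → V) (i : Fin (n + 1)), I.comap (A.bracket.toLinearMap x i)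

theorem mem_centralizerMod {I : Submodule K V} {w : V} :
    w ∈ A.centralizerMod I ↔ ∀ x i, x i = w → A.bracket x ∈ I := by
  simp only [centralizerMod, Submodule.mem_iInf, Submodule.mem_comap,
    MultilinearMap.toLinearMap_apply]
  constructor
  · rintro h x i rfl
    simpa using h x i
  · exact fun h x i => h _ i (by simp)

/-- When the other entries are homogeneous, the brackets with the different components of `w` have
different degrees. Each is therefore a homogeneous component of an element of the graded subspace
`I`. -/
theorem IsFirstClassNLie.isGradedSubspace_centralizerMod (hA : A.IsFirstClassNLie)
    {I : Submodule K V} (hI : A.IsGradedSubspace I) :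
    A.IsGradedSubspace (A.centralizerMod I) := by
  intro w hw a
  rw [mem_centralizerMod] at hw ⊢
  intro x i hx
  rw [A.multilinear_eq_sum_proj A.bracket x]
  refine Submodule.sum_mem _ fun c _ => ?_
  set y : Fin (n + 1) → V := fun j => A.proj (c j) (x j) with hy
  have hyc : A.Homogeneous c y := A.homogeneous_proj c x
  have hyi : y i = if c i = a then A.proj a w else 0 := by
    rw [hy, ← A.proj_proj, ← hx]
  by_cases hca : c i = a
  · rw [if_pos hca] at hyi
    have h1 := hI _ (hw (Function.update y i w) i (by simp)) (∑ j, c j)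
    have h2 : A.bracket (Function.update y i w) =
        ∑ b, A.bracket (Function.update y i (A.proj b w)) := by
      conv_lhs => rw [← A.sum_proj w]
      exact map_sum (A.bracket.toLinearMap y i) _ _
    have h3 : ∀ b, A.bracket (Function.update y i (A.proj b w)) ∈
        A.grade (b + ∑ j ∈ Finset.univ.erase i, c j) := by
      intro b
      have := hA.bracket_mem (Function.update c i b) (Function.update y i (A.proj b w))
        (fun j => by
          by_cases hj : j = i
          · subst hj; simpa using A.proj_mem b w
          · simpa [hj] using hyc j)
      rwa [Finset.sum_update_of_mem (Finset.mem_univ i), Finset.sdiff_singleton_eq_erase] at this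
    have h4 : ∑ j, c j = a + ∑ j ∈ Finset.univ.erase i, c j := by
      rw [← hca, Finset.add_sum_erase _ _ (Finset.mem_univ i)]
    rw [h2, map_sum, Finset.sum_eq_single a, h4, A.proj_of_mem (h3 a), ← hyi,
      Function.update_eq_self] at h1
    · exact h1
    · intro b _ hb
      refine A.proj_of_mem_ne (h3 b) ?_
      rw [h4]
      exact fun h => hb (add_right_cancel h).symm
    · simp
  · rw [if_neg hca] at hyi
    rw [A.bracket.map_coord_zero i hyi]
    exact I.zero_mem

/-- A homogeneous isotropic element `v` of `I^⊥` with `[v, g, ..., g] ⊆ I` lies in the maximal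
isotropic ideal `I`. -/
theorem IsMetric.mem_of_maximal (hB : A.IsMetric B) {I : Submodule K V}
    (hI : Maximal (fun U => A.IsGradedIdeal U ∧ IsIsotropic B U) I) {v : V} {a : ZMod 2}
    (hv : v ∈ A.grade a) (hvI : v ∈ B.orthogonal I) (hvc : v ∈ A.centralizerMod I)
    (hvv : B v v = 0) : v ∈ I := by
  have hgr := hI.prop.1.graded
  -- The enlarged space is again an isotropic graded ideal, so by maximality it is contained in `I`.
  have hp : A.IsGradedIdeal (I ⊔ K ∙ v) ∧ IsIsotropic B (I ⊔ K ∙ v) := by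
    refine ⟨⟨fun x hx b => ?_, fun x i hx => ?_⟩, fun x hx y hy => ?_⟩
    · obtain ⟨j, hj, u, hu, rfl⟩ := Submodule.mem_sup.1 hx
      obtain ⟨c, rfl⟩ := Submodule.mem_span_singleton.1 hu
      rw [map_add, map_smul]
      refine Submodule.add_mem_sup (hgr j hj b) (Submodule.smul_mem _ c ?_)
      by_cases hab : b = a
      · rw [hab, A.proj_of_mem hv]; exact Submodule.mem_span_singleton_self v
      · rw [A.proj_of_mem_ne hv hab]; exact Submodule.zero_mem _
    · obtain ⟨j, hj, u, hu, hju⟩ := Submodule.mem_sup.1 hx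
      obtain ⟨c, rfl⟩ := Submodule.mem_span_singleton.1 hu
      refine (le_sup_left : I ≤ _) ?_
      rw [← Function.update_eq_self i x, ← hju, MultilinearMap.map_update_add,
        MultilinearMap.map_update_smul]
      refine I.add_mem (hI.prop.1.ideal _ i (by simpa using hj)) (I.smul_mem _ ?_)
      exact mem_centralizerMod.1 hvc _ i (by simp)
    · obtain ⟨j, hj, u, hu, rfl⟩ := Submodule.mem_sup.1 hx
      obtain ⟨c, rfl⟩ := Submodule.mem_span_singleton.1 hu
      obtain ⟨j', hj', u', hu', rfl⟩ := Submodule.mem_sup.1 hy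
      obtain ⟨c', rfl⟩ := Submodule.mem_span_singleton.1 hu'
      have h1 : B j v = 0 := hvI j hj
      have h2 : B v j' = 0 := (hB.mem_orthogonal_iff hgr).1 hvI j' hj'
      simp [hI.prop.2 j hj j' hj', h1, h2, hvv]
  exact hI.le_of_ge hp le_sup_left (Submodule.mem_sup_right (Submodule.mem_span_singleton_self v))

/-- For a maximal isotropic graded ideal `I` of a nilpotent algebra, `[I^⊥, g, ..., g] ⊆ I`. -/
theorem IsMetric.orthogonal_le_centralizerMod [FiniteDimensional K V] (hA : A.IsFirstClassNLie)
    (hB : A.IsMetric B) (hnil : A.IsNilpotent) {I : Submodule K V}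
    (hI : Maximal (fun U => A.IsGradedIdeal U ∧ IsIsotropic B U) I) :
    B.orthogonal I ≤ A.centralizerMod I := by
  have hgr := hI.prop.1.graded
  set Z := B.orthogonal I ⊓ A.centralizerMod I with hZ
  have hZgr : A.IsGradedSubspace Z := fun x hx a =>
    ⟨hB.isGradedSubspace_orthogonal hgr x hx.1 a, hA.isGradedSubspace_centralizerMod hgr x hx.2 a⟩
  have hIZ : I ≤ Z := fun x hx => ⟨fun y hy => hI.prop.2 y hy x hx,
    mem_centralizerMod.2 fun y i hy => hI.prop.1.ideal y i (hy ▸ hx)⟩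
  have hZid : A.IsGradedIdeal Z := ⟨hZgr, fun x i hx => hIZ (mem_centralizerMod.1 hx.2 x i rfl)⟩
  have hY := hB.isGradedIdeal_orthogonal hA hZid
  have hYI : B.orthogonal Z ≤ B.orthogonal I := fun x hx y hy => hx y (hIZ hy)
  -- The components of `x` lie in both `Z` and `Z^⊥`, hence are isotropic, and maximality applies to
  -- each of them.
  have hZY : ∀ x ∈ Z, x ∈ B.orthogonal Z → x ∈ I := by
    intro x hx hx'
    rw [← A.sum_proj x]
    refine I.sum_mem fun a _ => ?_
    have h := hZgr x hx a
    exact hB.mem_of_maximal hI (A.proj_mem a x) h.1 h.2 (hY.graded x hx' a _ h)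
  -- Brackets with an entry in `Z^⊥ ∩ g^k` lie in `Z^⊥ ∩ g^{k+1} ⊆ I`. So `Z^⊥ ∩ g^k` lies in `Z` as
  -- well as in `Z^⊥`.
  have step : ∀ k, B.orthogonal Z ⊓ A.lowerSeries (k + 1) ≤ I →
      B.orthogonal Z ⊓ A.lowerSeries k ≤ I := by
    intro k hk x hx
    refine hZY x ⟨hYI hx.1, mem_centralizerMod.2 fun y i hy => ?_⟩ hx.1
    refine hA.bracket_mem_of_first (W := B.orthogonal Z ⊓ A.lowerSeries k)
      (fun u hu a => ⟨hY.graded u hu.1 a, hA.isGradedSubspace_lowerSeries k u hu.2 a⟩)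
      (fun z hz => hk ⟨hY.ideal z 0 hz.1, Submodule.subset_span ⟨z, hz.2, rfl⟩⟩) y i (hy ▸ hx)
  obtain ⟨k, hk⟩ := hnil
  have h0 : ∀ k, B.orthogonal Z ⊓ A.lowerSeries k ≤ I → B.orthogonal Z ≤ I := by
    intro k
    induction k with
    | zero => intro h x hx; exact h ⟨hx, trivial⟩
    | succ k ih => exact fun h => ih (step k h)
  have h1 : B.orthogonal Z ≤ I := h0 k (by rw [hk, inf_bot_eq]; exact bot_le)
  intro x hx
  -- Taking orthogonals in `Z^⊥ ⊆ I` gives `I^⊥ ⊆ Z^⊥⊥ = Z`.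
  have h2 : x ∈ B.orthogonal (B.orthogonal Z) := fun y hy => hx y (h1 hy)
  rw [hB.orthogonal_orthogonal hZgr] at h2
  exact h2.2

/-- The orthogonal space of a maximal isotropic graded ideal `I` of a nilpotent algebra is `I`, or it
exceeds `I` by an even anisotropic vector. -/
theorem IsMetric.orthogonal_of_maximal [IsAlgClosed K] [FiniteDimensional K V]
    (h2 : (2 : K) ≠ 0) (hA : A.IsFirstClassNLie) (hB : A.IsMetric B) (hnil : A.IsNilpotent)
    {I : Submodule K V} (hI : Maximal (fun U => A.IsGradedIdeal U ∧ IsIsotropic B U) I) :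
    (B.orthogonal I = I ∧ finrank K V = 2 * finrank K I) ∨
      ∃ e ∈ A.grade 0, B e e ≠ 0 ∧ B.orthogonal I = I ⊔ K ∙ e ∧
        finrank K V = 2 * finrank K I + 1 := by
  have hgr := hI.prop.1.graded
  have hc := hB.orthogonal_le_centralizerMod hA hnil hI
  have hoI : I ≤ B.orthogonal I := fun x hx y hy => hI.prop.2 y hy x hx
  have hfr := LinearMap.BilinForm.finrank_orthogonal hB.nondegenerate_form I
  have hfI := I.finrank_le
  -- The form is alternating on odd vectors because `2 ≠ 0`.
  have hodd : ∀ v ∈ B.orthogonal I, A.proj 1 v ∈ I := by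
    intro v hv
    have hv' := hB.isGradedSubspace_orthogonal hgr v hv 1
    refine hB.mem_of_maximal hI (A.proj_mem 1 v) hv' (hc hv') ?_
    have := hB.supersymmetric 1 1 _ _ (A.proj_mem 1 v) (A.proj_mem 1 v)
    simp only [mul_one, superSign, one_ne_zero, if_false, neg_one_mul] at this
    have h3 : (2 : K) * B (A.proj 1 v) (A.proj 1 v) = 0 := by linear_combination this
    exact (mul_eq_zero.1 h3).resolve_left h2
  have hsum : ∀ v, v = A.proj 0 v + A.proj 1 v := by
    intro v
    conv_lhs => rw [← A.sum_proj v]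
    exact Fin.sum_univ_two (fun a : Fin 2 => A.proj a v)
  by_cases hex : ∃ e ∈ A.grade 0, e ∈ B.orthogonal I ∧ e ∉ I
  · obtain ⟨e, he, heI, henI⟩ := hex
    have hee : B e e ≠ 0 := fun h => henI (hB.mem_of_maximal hI he heI (hc heI) h)
    have hperp : B.orthogonal I = I ⊔ K ∙ e := by
      refine le_antisymm (fun v hv => ?_) (sup_le hoI (by simpa using heI))
      rw [hsum v]
      refine Submodule.add_mem _ ?_ (Submodule.mem_sup_left (hodd v hv))
      have hv0 := hB.isGradedSubspace_orthogonal hgr v hv 0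
      set u := A.proj 0 v
      have hu : u ∈ A.grade 0 := A.proj_mem 0 v
      have hue : B u e = B e u := by
        simpa using hB.supersymmetric 0 0 u e hu he
      -- `t` is to be a root of `⟨u + t e, u + t e⟩ = ⟨e, e⟩ t² + 2 ⟨e, u⟩ t + ⟨u, u⟩`; `s` is a
      -- square root of a quarter of the discriminant.
      obtain ⟨s, hs⟩ := IsAlgClosed.exists_eq_mul_self (B e u * B e u - B e e * B u u)
      obtain ⟨t, ht⟩ : ∃ t, t = (s - B e u) / B e e := ⟨_, rfl⟩
      have ht' : t * B e e = s - B e u := by rw [ht]; field_simp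
      have hmem : u + t • e ∈ I := by
        refine hB.mem_of_maximal hI (a := 0) (Submodule.add_mem _ hu (Submodule.smul_mem _ t he))
          (Submodule.add_mem _ hv0 (Submodule.smul_mem _ t heI))
          (hc (Submodule.add_mem _ hv0 (Submodule.smul_mem _ t heI))) ?_
        simp only [map_add, map_smul, LinearMap.add_apply, LinearMap.smul_apply, smul_eq_mul, hue]
        -- Multiplied by `⟨e, e⟩`, the quadratic becomes `(t ⟨e, e⟩ + ⟨e, u⟩)² - s²`.
        refine (mul_eq_zero.1 (?_ : B e e * _ = 0)).resolve_left hee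
        linear_combination (t * B e e + s + B e u) * ht' - hs
      have : u = (u + t • e) + (-t) • e := by simp
      rw [this]
      exact Submodule.add_mem_sup hmem
        (Submodule.smul_mem _ _ (Submodule.mem_span_singleton_self e))
    refine Or.inr ⟨e, he, hee, hperp, ?_⟩
    have h3 : finrank K I < finrank K (B.orthogonal I) :=
      Submodule.finrank_lt_finrank_of_lt (lt_of_le_of_ne hoI fun h => henI (h ▸ heI))
    have h4 : finrank K (B.orthogonal I) ≤ finrank K I + 1 := by
      rw [hperp]
      exact (Submodule.finrank_add_le_finrank_add_finrank _ _).trans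
        (Nat.add_le_add_left (finrank_span_singleton (by rintro rfl; simp at hee)).le _)
    omega
  · have hperp : B.orthogonal I = I := by
      refine le_antisymm (fun v hv => ?_) hoI
      rw [hsum v]
      refine I.add_mem (by_contra fun h => hex ⟨_, A.proj_mem 0 v, ?_, h⟩) (hodd v hv)
      exact hB.isGradedSubspace_orthogonal hgr v hv 0
    refine Or.inl ⟨hperp, ?_⟩
    rw [hperp] at hfr
    omega

/-- If `[I^⊥, g, ..., g] ⊆ I`, then `I^⊥` is abelian. -/
theorem IsMetric.isAbelian_orthogonal (hA : A.IsFirstClassNLie)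
    (hB : A.IsMetric B) {I : Submodule K V} (hI : A.IsGradedIdeal I)
    (h : B.orthogonal I ≤ A.centralizerMod I) : A.IsAbelian (B.orthogonal I) := by
  intro x i j hij hi hj
  refine hB.nondegenerate _ fun z => ?_
  have hgr := hB.isGradedSubspace_orthogonal hI.graded
  -- Invariance leaves the pairing of `x i ∈ I^⊥` with a bracket that contains a component of `x j ∈
  -- I^⊥`; by `h` that bracket lies in `I`.
  refine hB.form_bracket_eq_zero hA i x fun a b => ?_
  refine (hB.mem_orthogonal_iff hI.graded).1 (hgr _ hi _) _ ?_
  obtain ⟨k, rfl⟩ := Fin.exists_succAbove_eq hij.symm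
  refine mem_centralizerMod.1 (h (hgr _ hj (a (i.succAbove k)))) _ k.castSucc ?_
  simp

end MaximalIsotropic

/-! ### Maps of degree zero -/

section GradedMaps

variable {K : Type*} [Field K] {V W : Type*} [AddCommGroup V] [Module K V] [AddCommGroup W]
  [Module K W] {n : ℕ} {A : NSuperalgebra K V n} {A' : NSuperalgebra K W n}

theorem map_proj {f : V →ₗ[K] W} (hf : ∀ a, ∀ x ∈ A.grade a, f x ∈ A'.grade a) (a : ZMod 2)
    (x : V) : f (A.proj a x) = A'.proj a (f x) := by
  conv_rhs => rw [← A.sum_proj x, map_sum, map_sum]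
  rw [Finset.sum_eq_single a, A'.proj_of_mem (hf a _ (A.proj_mem a x))]
  · exact fun b _ hb => A'.proj_of_mem_ne (hf b _ (A.proj_mem b x)) hb.symm
  · simp

theorem map_ad {f : V →ₗ[K] W}
    (hf : ∀ x : Fin (n + 1) → V, f (A.bracket x) = A'.bracket (fun i => f (x i)))
    (x : Fin n → V) (z : V) : f (A.ad x z) = A'.ad (fun i => f (x i)) (f z) := by
  rw [ad_apply, ad_apply, hf]
  congr 1
  exact Fin.comp_snoc f x z

theorem linearMap_ext_homogeneous (A : NSuperalgebra K V n) {f g : V →ₗ[K] W}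
    (h : ∀ a, ∀ x ∈ A.grade a, f x = g x) : f = g := by
  ext x
  rw [← A.sum_proj x, map_sum, map_sum]
  exact Finset.sum_congr rfl fun a _ => h a _ (A.proj_mem a x)

theorem bilin_ext_homogeneous (A : NSuperalgebra K V n) {f g : LinearMap.BilinForm K V}
    (h : ∀ a b, ∀ x ∈ A.grade a, ∀ y ∈ A.grade b, f x y = g x y) : f = g :=
  A.linearMap_ext_homogeneous fun a x hx =>
    A.linearMap_ext_homogeneous fun b y hy => h a b x hx y hy

end GradedMaps

/-! ### Transport of the laws along a bijective isometry -/

section Transport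

variable {K : Type*} [Field K] {V W : Type*} [AddCommGroup V] [Module K V] [AddCommGroup W]
  [Module K W] {n : ℕ} {A : NSuperalgebra K V n} {A' : NSuperalgebra K W n}
  {B : LinearMap.BilinForm K V} {B' : LinearMap.BilinForm K W} {φ : V →ₗ[K] W}

theorem IsIsometry.exists_mem_grade (h : IsIsometry A B A' B' φ) (hs : Function.Surjective φ)
    {a : ZMod 2} {w : W} (hw : w ∈ A'.grade a) : ∃ v ∈ A.grade a, φ v = w := by
  obtain ⟨v, rfl⟩ := hs w
  exact ⟨A.proj a v, A.proj_mem a v, by rw [map_proj h.map_grade, A'.proj_of_mem hw]⟩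

/-- Every law is stated for homogeneous tuples, so lifting these with their degrees is all that the
transport requires. -/
theorem IsIsometry.exists_homogeneous (h : IsIsometry A B A' B' φ) (hs : Function.Surjective φ)
    {ι : Type*} {a : ι → ZMod 2} {w : ι → W} (hw : A'.Homogeneous a w) :
    ∃ v, A.Homogeneous a v ∧ w = fun i => φ (v i) := by
  choose v hv hvw using fun i => h.exists_mem_grade hs (hw i)
  exact ⟨v, hv, funext fun i => (hvw i).symm⟩

theorem IsIsometry.isFirstClassNLie (h : IsIsometry A B A' B' φ) (hs : Function.Surjective φ)
    (hA : A.IsFirstClassNLie) : A'.IsFirstClassNLie where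
  bracket_mem a w hw := by
    obtain ⟨v, hv', rfl⟩ := h.exists_homogeneous hs hw
    rw [← h.map_bracket]
    exact h.map_grade _ _ (hA.bracket_mem a v hv')
  skew a w hw i := by
    obtain ⟨v, hv', rfl⟩ := h.exists_homogeneous hs hw
    rw [← h.map_bracket, hA.skew a v hv' i, map_neg, map_smul, h.map_bracket]
    rfl
  fundamental a w b y hw hy := by
    obtain ⟨w, hw', rfl⟩ := h.exists_homogeneous hs hw
    obtain ⟨y, hy', rfl⟩ := h.exists_homogeneous hs hy
    rw [← h.map_bracket, ← map_ad h.map_bracket, hA.fundamental a w b y hw' hy', map_sum]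
    refine Finset.sum_congr rfl fun i _ => ?_
    rw [map_smul, h.map_bracket, ← map_ad h.map_bracket]
    congr 2
    exact Function.comp_update φ y i _

theorem IsIsometry.isMetric (h : IsIsometry A B A' B' φ) (hs : Function.Surjective φ)
    (hB : A.IsMetric B) : A'.IsMetric B' where
  nondegenerate w hw := by
    obtain ⟨v, rfl⟩ := hs w
    rw [hB.nondegenerate v fun y => by rw [← h.map_form, hw], map_zero]
  invariant a b c w y z hw hy hz := by
    obtain ⟨w, hw', rfl⟩ := h.exists_homogeneous hs hw
    obtain ⟨y, hy', rfl⟩ := h.exists_mem_grade hs hy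
    obtain ⟨z, hz', rfl⟩ := h.exists_mem_grade hs hz
    rw [← map_ad h.map_bracket, ← map_ad h.map_bracket, h.map_form, h.map_form,
      hB.invariant a b c w y z hw' hy' hz']
  supersymmetric a b x y hx hy := by
    obtain ⟨x, hx', rfl⟩ := h.exists_mem_grade hs hx
    obtain ⟨y, hy', rfl⟩ := h.exists_mem_grade hs hy
    rw [h.map_form, h.map_form, hB.supersymmetric a b x y hx' hy']
  consistent a b x y hx hy hab := by
    obtain ⟨x, hx', rfl⟩ := h.exists_mem_grade hs hx
    obtain ⟨y, hy', rfl⟩ := h.exists_mem_grade hs hy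
    rw [h.map_form, hB.consistent a b x y hx' hy' hab]

end Transport

/-! ### Reading the cocycle identities off the extension -/

section Cocycle

variable {K : Type*} [Field K] {V : Type*} [AddCommGroup V] [Module K V] {n : ℕ}
  {A : NSuperalgebra K V n} {θ : MultilinearMap K (fun _ : Fin (n + 1) => V) (Dual K V)}

theorem coadAt_zero (A : NSuperalgebra K V n) (i : Fin (n + 1)) (a : Fin (n + 1) → ZMod 2)
    (x : Fin (n + 1) → V) : A.coadAt i a x 0 = 0 := by
  simp [coadAt, coad]

theorem coadAt_eq_zero (A : NSuperalgebra K V n) {i k : Fin (n + 1)} (hik : k ≠ i)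
    (a : Fin (n + 1) → ZMod 2) {x : Fin (n + 1) → V} (hx : x k = 0) (f : Dual K V) :
    A.coadAt i a x f = 0 := by
  obtain ⟨j, rfl⟩ := Fin.exists_succAbove_eq hik
  have : A.ad (fun l => x (i.succAbove l)) = 0 := by
    ext z
    rw [ad_apply]
    exact A.bracket.map_coord_zero j.castSucc (by simpa using hx)
  simp [coadAt, coad, this]

theorem coadAt_congr (A : NSuperalgebra K V n) (i : Fin (n + 1)) (a : Fin (n + 1) → ZMod 2)
    {x y : Fin (n + 1) → V} (h : ∀ j ≠ i, x j = y j) (f : Dual K V) :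
    A.coadAt i a x f = A.coadAt i a y f := by
  have : (fun j => x (i.succAbove j)) = fun j => y (i.succAbove j) :=
    funext fun j => h _ (Fin.succAbove_ne i j)
  simp only [coadAt, this]

theorem coadAt_last_snoc (A : NSuperalgebra K V n) (a : Fin n → ZMod 2) (b : ZMod 2)
    (x : Fin n → V) (y : V) (f : Dual K V) :
    A.coadAt (Fin.last n) (Fin.snoc a b : Fin (n + 1) → ZMod 2) (Fin.snoc x y) f =
      A.coad (∑ j, a j) x b f := by
  rw [coadAt, Finset.Ioi_eq_empty.2 fun b _ => Fin.le_last b]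
  simp

theorem homogeneous_mk_zero {ι : Type*} {a : ι → ZMod 2} {x : ι → V} (hx : A.Homogeneous a x) :
    (A.tstar θ).Homogeneous a fun i => ((x i, 0) : V × Dual K V) :=
  fun i => ⟨hx i, Submodule.zero_mem _⟩

theorem Homogeneous.snoc {A : NSuperalgebra K V n} {m : ℕ} {a : Fin m → ZMod 2} {b : ZMod 2}
    {x : Fin m → V} {y : V} (hx : A.Homogeneous a x) (hy : y ∈ A.grade b) :
    A.Homogeneous (Fin.snoc a b : Fin (m + 1) → ZMod 2) (Fin.snoc x y : Fin (m + 1) → V) := by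
  intro i
  refine Fin.lastCases ?_ (fun i => ?_) i
  · simpa using hy
  · simpa using hx i

theorem Homogeneous.update {A : NSuperalgebra K V n} {ι : Type*} [DecidableEq ι] {a : ι → ZMod 2}
    {b : ZMod 2} {x : ι → V} {y : V} (hx : A.Homogeneous a x) (i : ι) (hy : y ∈ A.grade b) :
    A.Homogeneous (Function.update a i b) (Function.update x i y) := by
  intro j
  by_cases hj : j = i
  · subst hj; simpa using hy
  · simpa [hj] using hx j

theorem tstar_bracket_mk_zero {a : Fin (n + 1) → ZMod 2} {x : Fin (n + 1) → V}
    (hx : A.Homogeneous a x) :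
    (A.tstar θ).bracket (fun i => (x i, 0)) = (A.bracket x, θ x) := by
  rw [A.tstar_bracket_of_homogeneous θ a _ (homogeneous_mk_zero hx)]
  simp only [coadAt_zero, Finset.sum_const_zero, add_zero]

/-- Only the entry at place `i` has a dual component, so a single coadjoint term survives. -/
theorem tstar_bracket_update_mk_zero {a : Fin (n + 1) → ZMod 2} {x : Fin (n + 1) → V}
    {b : ZMod 2} {i : Fin (n + 1)} {u : V × Dual K V} (hx : A.Homogeneous a x)
    (hu : u ∈ (A.tstar θ).grade b) :
    (A.tstar θ).bracket (Function.update (fun i => (x i, 0)) i u) =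
      (A.bracket (Function.update x i u.1),
        θ (Function.update x i u.1) + A.coadAt i (Function.update a i b) x u.2) := by
  rw [A.tstar_bracket_of_homogeneous θ _ _ ((homogeneous_mk_zero hx).update i hu)]
  have h1 : (fun j => (Function.update (fun i => ((x i, 0) : V × Dual K V)) i u j).1) =
      Function.update x i u.1 := by
    ext j
    by_cases hj : j = i
    · subst hj; simp
    · simp [hj]
  rw [h1, Finset.sum_eq_single i]
  · rw [Function.update_self, A.coadAt_congr i _ fun j hj => Function.update_of_ne hj _ _]
  · intro j _ hj
    rw [Function.update_of_ne hj, coadAt_zero]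
  · simp

theorem tstar_ad_mk_zero {a : Fin n → ZMod 2} {x : Fin n → V} {b : ZMod 2} {u : V × Dual K V}
    (hx : A.Homogeneous a x) (hu : u ∈ (A.tstar θ).grade b) :
    (A.tstar θ).ad (fun i => (x i, 0)) u =
      (A.ad x u.1, θ (Fin.snoc x u.1) + A.coad (∑ j, a j) x b u.2) := by
  have h1 : (Fin.snoc (fun i => ((x i, 0) : V × Dual K V)) u : Fin (n + 1) → V × Dual K V) =
      Function.update (fun i => ((Fin.snoc x 0 : Fin (n + 1) → V) i, 0)) (Fin.last n) u := by
    ext j : 1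
    refine Fin.lastCases ?_ (fun j => ?_) j
    · simp
    · simp [(Fin.castSucc_lt_last j).ne]
  have h2 : Homogeneous A (Fin.snoc a b : Fin (n + 1) → ZMod 2) (Fin.snoc x 0 : Fin (n + 1) → V) :=
    hx.snoc (Submodule.zero_mem _)
  rw [ad_apply, h1, tstar_bracket_update_mk_zero h2 hu, Fin.update_snoc_last, Fin.update_snoc_last,
    coadAt_last_snoc]
  rfl

/-- If the bracket on `g ⊕ g^*` given by `θ` is that of a metric first-class algebra, then `θ` is a
supercyclic cocycle. -/
theorem isSupercyclicCocycle_of_tstar (hT : (A.tstar θ).IsFirstClassNLie)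
    (hM : (A.tstar θ).IsMetric A.tstarForm) : A.IsSupercyclicCocycle θ where
  degree a x hx := by
    have h := hT.bracket_mem a _ (homogeneous_mk_zero hx)
    rw [tstar_bracket_mk_zero hx] at h
    exact h.2
  skew a x hx i := by
    have h := hT.skew a _ (homogeneous_mk_zero hx) i
    have h2 := tstar_bracket_mk_zero (θ := θ) (hx.comp (Equiv.swap i.castSucc i.succ))
    rw [tstar_bracket_mk_zero hx] at h
    exact congrArg Prod.snd (h.trans (congrArg (fun v => -(_ • v)) h2))
  cocycle a x b y hx hy := by
    have hby := hT.bracket_mem b _ (homogeneous_mk_zero hy)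
    -- On tuples without dual components, the dual component of the fundamental identity is the
    -- cocycle identity.
    have h := hT.fundamental a _ b _ (homogeneous_mk_zero hx) (homogeneous_mk_zero hy)
    rw [tstar_ad_mk_zero hx hby, tstar_bracket_mk_zero hy] at h
    have hr : ∀ i, (A.tstar θ).bracket (Function.update (fun i => (y i, 0)) i
        ((A.tstar θ).ad (fun i => (x i, 0)) (y i, 0))) =
        (A.bracket (Function.update y i (A.ad x (y i))),
          θ (Function.update y i (A.ad x (y i))) +
          A.coadAt i (Function.update b i ((∑ j, a j) + b i)) y (θ (Fin.snoc x (y i)))) := by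
      intro i
      have h1 : ((y i, 0) : V × Dual K V) ∈ (A.tstar θ).grade (b i) :=
        ⟨hy i, Submodule.zero_mem _⟩
      rw [tstar_bracket_update_mk_zero hy (hT.ad_mem (homogeneous_mk_zero hx) h1),
        tstar_ad_mk_zero hx h1]
      simp [coad]
    simp only [hr] at h
    have h' := congrArg Prod.snd h
    simp only [Prod.snd_sum, Prod.smul_snd, smul_add, Finset.sum_add_distrib] at h'
    rw [h', add_sub_cancel_left, sub_self]
  supercyclic a b c x y z hx hy hz := by
    have hy' : ((y, 0) : V × Dual K V) ∈ (A.tstar θ).grade b := ⟨hy, Submodule.zero_mem _⟩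
    have hz' : ((z, 0) : V × Dual K V) ∈ (A.tstar θ).grade c := ⟨hz, Submodule.zero_mem _⟩
    -- Both pairings reduce to values of `θ`. The form contributes the sign of `|y|(|x| + |z|)`,
    -- whose factor for `|x||y|` cancels the sign in the invariance law.
    have h := hM.invariant a b c _ _ _ (homogeneous_mk_zero hx) hy' hz'
    have h1 := hT.ad_mem (homogeneous_mk_zero hx) hy'
    have h2 := hT.ad_mem (homogeneous_mk_zero hx) hz'
    rw [A.tstarForm_of_homogeneous _ c _ _ h1.1 hz'.2,
      A.tstarForm_of_homogeneous b _ _ _ hy'.1 h2.2, tstar_ad_mk_zero hx hy',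
      tstar_ad_mk_zero hx hz', superSign_add_right, mul_comm b] at h
    simp only [coad, LinearMap.zero_comp, smul_zero, neg_zero, add_zero, LinearMap.zero_apply,
      mul_zero, zero_add] at h
    rw [h]
    linear_combination (-superSign K (b * c) * θ (Fin.snoc x z) y) *
      superSign_mul_self (K := K) ((∑ i, a i) * b)

end Cocycle

/-! ### Algebras with a Lagrangian ideal -/

section Lagrangian

variable {K : Type*} [Field K] {V Q : Type*} [AddCommGroup V] [Module K V] [AddCommGroup Q]
  [Module K Q] {n : ℕ} {A : NSuperalgebra K V n} {A' : NSuperalgebra K Q n}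
  {B : LinearMap.BilinForm K V} {π : V →ₗ[K] Q}

theorem isGradedSubspace_ker (hπ : ∀ a, ∀ x ∈ A.grade a, π x ∈ A'.grade a) :
    A.IsGradedSubspace (LinearMap.ker π) := by
  intro x hx a
  rw [LinearMap.mem_ker] at hx ⊢
  rw [map_proj hπ, hx, map_zero]

/-- The degree-zero part of any linear section is still a section, because `π` commutes with taking
components. -/
theorem exists_graded_section (hπ : ∀ a, ∀ x ∈ A.grade a, π x ∈ A'.grade a)
    (hs : Function.Surjective π) :
    ∃ s : Q →ₗ[K] V, (∀ x, π (s x) = x) ∧ ∀ a, ∀ x ∈ A'.grade a, s x ∈ A.grade a := by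
  obtain ⟨t, ht⟩ := π.exists_rightInverse_of_surjective (LinearMap.range_eq_top.2 hs)
  have ht' : ∀ x, π (t x) = x := LinearMap.congr_fun ht
  refine ⟨∑ a, A.proj a ∘ₗ t ∘ₗ A'.proj a, fun x => ?_, fun a x hx => ?_⟩
  · simp [map_sum, map_proj hπ, ht', proj_proj, sum_proj]
  · rw [LinearMap.sum_apply]
    refine Submodule.sum_mem _ fun b _ => ?_
    by_cases hb : b = a
    · subst hb; exact A.proj_mem _ _
    · simp [A'.proj_of_mem_ne hx hb]

theorem IsMetric.form_eq_zero_of_orthogonal_ker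
    (hL : B.orthogonal (LinearMap.ker π) = LinearMap.ker π) {u v : V} (hu : π u = 0)
    (hv : π v = 0) : B u v = 0 := by
  have : v ∈ B.orthogonal (LinearMap.ker π) := by rw [hL]; exact LinearMap.mem_ker.2 hv
  exact this u (LinearMap.mem_ker.2 hu)

/-- An element of a Lagrangian subspace is zero if it is orthogonal to a complement. -/
theorem IsMetric.eq_zero_of_section (hB : A.IsMetric B)
    (hL : B.orthogonal (LinearMap.ker π) = LinearMap.ker π) {s : Q →ₗ[K] V}
    (hs : ∀ x, π (s x) = x) {u : V} (hu : π u = 0) (h : ∀ y, B u (s y) = 0) : u = 0 := by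
  refine hB.nondegenerate u fun w => ?_
  have h1 : B u (w - s (π w)) = 0 :=
    IsMetric.form_eq_zero_of_orthogonal_ker hL hu (by rw [map_sub, hs, sub_self])
  rwa [map_sub, h, sub_zero] at h1

theorem IsMetric.finrank_eq_of_orthogonal_ker [FiniteDimensional K V] (hB : A.IsMetric B)
    (hs : Function.Surjective π) (hL : B.orthogonal (LinearMap.ker π) = LinearMap.ker π) :
    finrank K (LinearMap.ker π) = finrank K Q ∧ finrank K V = 2 * finrank K Q := by
  have h1 := π.finrank_range_add_finrank_ker
  rw [LinearMap.range_eq_top.2 hs, finrank_top] at h1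
  have h2 := LinearMap.BilinForm.finrank_orthogonal hB.nondegenerate_form (LinearMap.ker π)
  rw [hL] at h2
  omega

/-- A Lagrangian graded subspace has an isotropic graded complement. -/
theorem IsMetric.exists_isotropic_section [FiniteDimensional K V] (h2 : (2 : K) ≠ 0)
    (hB : A.IsMetric B) (hπ : ∀ a, ∀ x ∈ A.grade a, π x ∈ A'.grade a)
    (hs : Function.Surjective π) (hL : B.orthogonal (LinearMap.ker π) = LinearMap.ker π) :
    ∃ s : Q →ₗ[K] V, (∀ x, π (s x) = x) ∧ (∀ a, ∀ x ∈ A'.grade a, s x ∈ A.grade a) ∧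
      ∀ x y, B (s x) (s y) = 0 := by
  have : FiniteDimensional K Q := Module.Finite.of_surjective π hs
  obtain ⟨t, ht, htg⟩ := exists_graded_section hπ hs
  -- The form identifies the Lagrangian kernel with `Q^*`: injectively by nondegeneracy, bijectively
  -- by dimension. This allows `t` to be corrected by a prescribed functional.
  let D : LinearMap.ker π →ₗ[K] Dual K Q := (B.compl₂ t) ∘ₗ (LinearMap.ker π).subtype
  have hD : ∀ u y, D u y = B u (t y) := fun _ _ => rfl
  have hDi : Function.Injective D := by
    rw [injective_iff_map_eq_zero]
    intro u hu
    refine Subtype.ext (hB.eq_zero_of_section hL ht u.2 fun y => ?_)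
    rw [← hD, hu, LinearMap.zero_apply]
  have hDs : Function.Surjective D := by
    refine (LinearMap.injective_iff_surjective_of_finrank_eq_finrank ?_).1 hDi
    rw [(hB.finrank_eq_of_orthogonal_ker hs hL).1, Subspace.dual_finrank_eq]
  let E := LinearEquiv.ofBijective D ⟨hDi, hDs⟩
  -- With `⟨h x, t y⟩ = -½ ⟨t x, t y⟩`, the two cross terms of `⟨(t + h) x, (t + h) y⟩` cancel `⟨t
  -- x, t y⟩`, and `⟨h x, h y⟩ = 0`.
  let h : Q →ₗ[K] V := (LinearMap.ker π).subtype ∘ₗ E.symm.toLinearMap ∘ₗ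
    ((-(2 : K)⁻¹) • (B.compl₂ t ∘ₗ t))
  have hh : ∀ x y, B (h x) (t y) = -(2 : K)⁻¹ * B (t x) (t y) := by
    intro x y
    have : D (E.symm ((-(2 : K)⁻¹) • (B.compl₂ t ∘ₗ t) x)) =
        (-(2 : K)⁻¹) • (B.compl₂ t ∘ₗ t) x := E.apply_symm_apply _
    exact LinearMap.congr_fun this y
  have hk : ∀ x, π (h x) = 0 := fun x => (E.symm _).2
  have hhg : ∀ a, ∀ x ∈ A'.grade a, h x ∈ A.grade a := by
    intro a x hx
    rw [← A.sum_proj (h x)]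
    refine Submodule.sum_mem _ fun b _ => ?_
    by_cases hb : b = a
    · subst hb; exact A.proj_mem _ _
    -- The component of the wrong degree lies in the kernel and, by consistency, is orthogonal to
    -- the image of `t`.
    · have : A.proj b (h x) = 0 := by
        refine hB.eq_zero_of_section hL ht (isGradedSubspace_ker hπ _ (hk x) b) fun y => ?_
        rw [hB.proj_left, ← hB.proj_right, ← map_proj htg, hh,
          hB.consistent a b _ _ (htg a x hx) (htg b _ (A'.proj_mem b y)) (Ne.symm hb), mul_zero]
      rw [this]
      exact Submodule.zero_mem _
  refine ⟨t + h, fun x => by simp [ht, hk], fun a x hx => ?_, fun x y => ?_⟩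
  · exact Submodule.add_mem _ (htg a x hx) (hhg a x hx)
  · have key : B.compl₁₂ (t + h) (t + h) = 0 := by
      refine A'.bilin_ext_homogeneous fun a b x hx y hy => ?_
      have h1 := hB.supersymmetric a b _ _ (htg a x hx) (hhg b y hy)
      have h3 := hB.supersymmetric a b _ _ (htg a x hx) (htg b y hy)
      have h4 := IsMetric.form_eq_zero_of_orthogonal_ker hL (hk x) (hk y)
      have h5 : (2 : K) * 2⁻¹ = 1 := mul_inv_cancel₀ h2
      simp only [LinearMap.compl₁₂_apply, LinearMap.add_apply, map_add, LinearMap.zero_apply]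
      rw [hh] at h1 ⊢
      linear_combination h1 + h4 + (2 : K)⁻¹ * h3 - B (t x) (t y) * h5
    exact LinearMap.congr_fun₂ key x y

/-- The map `v ↦ (π v, ⟨v, s ·⟩)` to `Q ⊕ Q^*`. -/
def toTstar (B : LinearMap.BilinForm K V) (π : V →ₗ[K] Q) (s : Q →ₗ[K] V) :
    V →ₗ[K] Q × Dual K Q :=
  π.prod (B.compl₂ s)

/-- The cocycle `⟨[s x_0, ..., s x_n], s z⟩`. -/
def sectionCocycle (A : NSuperalgebra K V n) (B : LinearMap.BilinForm K V) (s : Q →ₗ[K] V) :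
    MultilinearMap K (fun _ : Fin (n + 1) => Q) (Dual K Q) :=
  (B.compl₂ s).compMultilinearMap (A.bracket.compLinearMap fun _ => s)

/-- The vectors `x - s (π x)` and `y - s (π y)` lie in the Lagrangian kernel. Expanding their
pairing, with `s` isotropic, gives `⟨x, y⟩ = ⟨x, s (π y)⟩ + ⟨s (π x), y⟩`. -/
theorem IsMetric.tstarForm_toTstar (hB : A.IsMetric B)
    (hπ : ∀ a, ∀ x ∈ A.grade a, π x ∈ A'.grade a)
    (hL : B.orthogonal (LinearMap.ker π) = LinearMap.ker π) {s : Q →ₗ[K] V}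
    (hs : ∀ x, π (s x) = x) (hsg : ∀ a, ∀ x ∈ A'.grade a, s x ∈ A.grade a)
    (hsi : ∀ x y, B (s x) (s y) = 0) (x y : V) :
    A'.tstarForm (toTstar B π s x) (toTstar B π s y) = B x y := by
  have key : A'.tstarForm.compl₁₂ (toTstar B π s) (toTstar B π s) = B := by
    refine A.bilin_ext_homogeneous fun a b x hx y hy => ?_
    have hyd : (toTstar B π s y).2 ∈ A'.dualGrade b := by
      refine (Submodule.mem_dualAnnihilator _).2 fun z hz => ?_
      exact hB.consistent b (b + 1) _ _ hy (hsg _ z hz) (by simp)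
    rw [LinearMap.compl₁₂_apply, A'.tstarForm_of_homogeneous a b _ _ (hπ a x hx) hyd]
    change B x (s (π y)) + superSign K (a * b) * B y (s (π x)) = B x y
    have h1 := hB.supersymmetric a b _ _ (hsg a _ (hπ a x hx)) hy
    have h3 : B (x - s (π x)) (y - s (π y)) = 0 :=
      IsMetric.form_eq_zero_of_orthogonal_ker hL (by rw [map_sub, hs, sub_self])
        (by rw [map_sub, hs, sub_self])
    simp only [map_sub, LinearMap.sub_apply, hsi] at h3
    linear_combination -h1 - h3
  exact LinearMap.congr_fun₂ key x y

/-- It suffices to take homogeneous entries, each in the kernel of `π` or in the image of `s`. If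
some entry lies in the kernel, invariance turns the dual component into the coadjoint term at its
place, while `θ` and all other terms vanish. If none does, all functionals vanish and `θ` remains,
by its definition. -/
theorem IsMetric.toTstar_bracket (hA : A.IsFirstClassNLie) (hB : A.IsMetric B)
    (hπ : ∀ a, ∀ x ∈ A.grade a, π x ∈ A'.grade a)
    (hπb : ∀ x : Fin (n + 1) → V, π (A.bracket x) = A'.bracket fun i => π (x i))
    (hL : B.orthogonal (LinearMap.ker π) = LinearMap.ker π) {s : Q →ₗ[K] V}
    (hs : ∀ x, π (s x) = x) (hsg : ∀ a, ∀ x ∈ A'.grade a, s x ∈ A.grade a)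
    (hsi : ∀ x y, B (s x) (s y) = 0)
    (hφg : ∀ a, ∀ x ∈ A.grade a,
      toTstar B π s x ∈ (A'.tstar (sectionCocycle A B s)).grade a) (x : Fin (n + 1) → V) :
    toTstar B π s (A.bracket x) =
      (A'.tstar (sectionCocycle A B s)).bracket fun i => toTstar B π s (x i) := by
  set θ := sectionCocycle A B s with hθ
  set φ := toTstar B π s with hφ
  let S : Set V := {v | (∃ a, v ∈ A.grade a) ∧ (π v = 0 ∨ s (π v) = v)}
  have hS : Submodule.span K S = ⊤ := by
    refine eq_top_iff.2 fun v _ => ?_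
    rw [← A.sum_proj v]
    refine Submodule.sum_mem _ fun a _ => ?_
    have h1 := A.proj_mem a v
    set u := A.proj a v
    have h3 := hsg a _ (hπ a u h1)
    rw [← sub_add_cancel u (s (π u))]
    refine Submodule.add_mem _ (Submodule.subset_span ⟨⟨a, Submodule.sub_mem _ h1 h3⟩, Or.inl ?_⟩)
      (Submodule.subset_span ⟨⟨a, h3⟩, Or.inr ?_⟩)
    · rw [map_sub, hs, sub_self]
    · rw [hs]
  have key : φ.compMultilinearMap A.bracket =
      (A'.tstar θ).bracket.compLinearMap fun _ => φ := by
    refine multilinear_ext_of_span hS _ _ fun x hx => ?_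
    choose a ha using fun i => (hx i).1
    change φ (A.bracket x) = (A'.tstar θ).bracket fun i => φ (x i)
    rw [A'.tstar_bracket_of_homogeneous θ a _ fun i => hφg _ _ (ha i)]
    refine Prod.ext (hπb x) ?_
    change (B.compl₂ s) (A.bracket x) = θ (fun i => π (x i)) +
      ∑ i, A'.coadAt i a (fun j => π (x j)) (φ (x i)).2
    by_cases hk : ∃ k, π (x k) = 0
    · obtain ⟨k, hk⟩ := hk
      rw [θ.map_coord_zero k hk, zero_add, Finset.sum_eq_single k]
      · refine A'.linearMap_ext_homogeneous fun b z hz => ?_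
        -- The section need not be a homomorphism, but its defect lies in the kernel, which is
        -- orthogonal to `x k`.
        have h1 : B (x k) (A.ad (fun j => x (k.succAbove j)) (s z)) =
            B (x k) (s (A'.ad (fun j => π (x (k.succAbove j))) z)) := by
          rw [← sub_eq_zero, ← map_sub]
          refine IsMetric.form_eq_zero_of_orthogonal_ker hL hk ?_
          rw [map_sub, hs, map_ad hπb, hs, sub_self]
        change B (A.bracket x) (s z) = _
        rw [hA.bracket_eq_ad k a x ha, map_smul, LinearMap.smul_apply,
          hB.invariant (fun j => a (k.succAbove j)) (a k) b _ _ _ (fun j => ha (k.succAbove j))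
            (ha k) (hsg b z hz), h1]
        rfl
      · exact fun i _ hi => A'.coadAt_eq_zero hi.symm a hk _
      · simp
    · have hx' : ∀ i, s (π (x i)) = x i := fun i =>
        (hx i).2.resolve_left fun h => hk ⟨i, h⟩
      have hzero : ∀ i, (φ (x i)).2 = 0 := by
        intro i
        ext z
        change B (x i) (s z) = 0
        rw [← hx', hsi]
      simp only [hzero, coadAt_zero, Finset.sum_const_zero, add_zero]
      change _ = (B.compl₂ s) (A.bracket fun i => s (π (x i)))
      simp only [hx']
  exact congrArg (fun f => f x) key

/-- A metric first-class algebra with a Lagrangian graded ideal, the kernel of `π`, is isometric to a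
`T^*`-extension of its image under `π`. -/
theorem IsMetric.exists_isometry_tstar [FiniteDimensional K V] (h2 : (2 : K) ≠ 0)
    (hA : A.IsFirstClassNLie) (hB : A.IsMetric B)
    (hπ : ∀ a, ∀ x ∈ A.grade a, π x ∈ A'.grade a)
    (hπb : ∀ x : Fin (n + 1) → V, π (A.bracket x) = A'.bracket fun i => π (x i))
    (hs : Function.Surjective π) (hL : B.orthogonal (LinearMap.ker π) = LinearMap.ker π) :
    ∃ θ, A'.IsSupercyclicCocycle θ ∧ (A'.tstar θ).IsFirstClassNLie ∧
      (A'.tstar θ).IsMetric A'.tstarForm ∧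
      ∃ φ : V →ₗ[K] Q × Dual K Q, IsIsometry A B (A'.tstar θ) A'.tstarForm φ ∧
        Function.Surjective φ := by
  have : FiniteDimensional K Q := Module.Finite.of_surjective π hs
  obtain ⟨s, hsπ, hsg, hsi⟩ := hB.exists_isotropic_section h2 hπ hs hL
  have hφg : ∀ a, ∀ x ∈ A.grade a,
      toTstar B π s x ∈ (A'.tstar (sectionCocycle A B s)).grade a := by
    refine fun a x hx => ⟨hπ a x hx, (Submodule.mem_dualAnnihilator _).2 fun z hz => ?_⟩
    exact hB.consistent a (a + 1) _ _ hx (hsg _ z hz) (by simp)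
  have hiso : IsIsometry A B (A'.tstar (sectionCocycle A B s)) A'.tstarForm (toTstar B π s) := by
    refine ⟨?_, hφg, hB.toTstar_bracket hA hπ hπb hL hsπ hsg hsi hφg,
      hB.tstarForm_toTstar hπ hL hsπ hsg hsi⟩
    rw [injective_iff_map_eq_zero]
    intro v hv
    exact hB.eq_zero_of_section hL hsπ (congrArg Prod.fst hv)
      fun y => LinearMap.congr_fun (congrArg Prod.snd hv) y
  have hsurj : Function.Surjective (toTstar B π s) := by
    refine (LinearMap.injective_iff_surjective_of_finrank_eq_finrank ?_).1 hiso.injective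
    rw [(hB.finrank_eq_of_orthogonal_ker hs hL).2, finrank_prod, Subspace.dual_finrank_eq, two_mul]
  -- The extension inherits its laws from `A`; the conditions on `θ` follow from them.
  have hT := hiso.isFirstClassNLie hsurj hA
  have hM := hiso.isMetric hsurj hB
  exact ⟨_, isSupercyclicCocycle_of_tstar hT hM, hT, hM, _, hiso, hsurj⟩

end Lagrangian

/-! ### Odd dimension: adding a central line -/

section AddLine

variable {K : Type*} [Field K] {V : Type*} [AddCommGroup V] [Module K V] {n : ℕ}

/-- The grading of a one-dimensional even space. -/
def lineGrade (K : Type*) [Field K] (a : ZMod 2) : Submodule K K := if a = 0 then ⊤ else ⊥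

theorem isCompl_lineGrade (a : ZMod 2) : IsCompl (lineGrade K a) (lineGrade K (a + 1)) := by
  have h : (1 + 1 : ZMod 2) = 0 := by decide
  rcases zmod_two_cases a with rfl | rfl
  · simpa [lineGrade] using isCompl_top_bot
  · simpa [lineGrade, h] using isCompl_bot_top

/-- The direct sum of an algebra with an even line with zero bracket. -/
def addLine (A : NSuperalgebra K V n) : NSuperalgebra K (V × K) n where
  grade a := (A.grade a).prod (lineGrade K a)
  isCompl a := by
    constructor
    · rw [disjoint_iff, Submodule.prod_inf_prod, (A.isCompl a).inf_eq_bot,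
        (isCompl_lineGrade a).inf_eq_bot, Submodule.prod_bot]
    · rw [codisjoint_iff, Submodule.prod_sup_prod, (A.isCompl a).sup_eq_top,
        (isCompl_lineGrade a).sup_eq_top, Submodule.prod_top]
  bracket := (LinearMap.inl K V K).compMultilinearMap
    (A.bracket.compLinearMap fun _ => LinearMap.fst K V K)

/-- The orthogonal sum of a form with the form `-β t u` on a line. -/
def addLineForm (B : LinearMap.BilinForm K V) (β : K) : LinearMap.BilinForm K (V × K) :=
  B.compl₁₂ (LinearMap.fst K V K) (LinearMap.fst K V K) -
    β • (LinearMap.mul K K).compl₁₂ (LinearMap.snd K V K) (LinearMap.snd K V K)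

theorem addLineForm_apply (B : LinearMap.BilinForm K V) (β : K) (u v : V × K) :
    addLineForm B β u v = B u.1 v.1 - β * (u.2 * v.2) := rfl

variable {A : NSuperalgebra K V n} {B : LinearMap.BilinForm K V}

theorem addLine_bracket (x : Fin (n + 1) → V × K) :
    A.addLine.bracket x = (A.bracket fun i => (x i).1, 0) := rfl

theorem addLine_ad (x : Fin n → V × K) (z : V × K) :
    A.addLine.ad x z = (A.ad (fun i => (x i).1) z.1, 0) := by
  rw [ad_apply, addLine_bracket, ad_apply]
  congr 2
  exact Fin.comp_snoc Prod.fst x z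

theorem Homogeneous.fst {ι : Type*} {a : ι → ZMod 2} {x : ι → V × K}
    (hx : A.addLine.Homogeneous a x) : A.Homogeneous a fun i => (x i).1 := fun i => (hx i).1

theorem IsFirstClassNLie.addLine (hA : A.IsFirstClassNLie) : A.addLine.IsFirstClassNLie where
  bracket_mem a x hx := ⟨hA.bracket_mem a _ hx.fst, Submodule.zero_mem _⟩
  skew a x hx i := by
    rw [addLine_bracket, addLine_bracket, hA.skew a _ hx.fst i]
    simp [Function.comp_def]
  fundamental a x b y hx hy := by
    rw [addLine_ad, addLine_bracket, hA.fundamental a _ b _ hx.fst hy.fst]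
    refine Prod.ext ?_ ?_
    · rw [Prod.fst_sum]
      dsimp only
      refine Finset.sum_congr rfl fun i _ => ?_
      rw [addLine_bracket, addLine_ad, Prod.smul_fst]
      congr 2
      exact (Function.comp_update Prod.fst y i (A.ad (fun i => (x i).1) (y i).1, (0 : K))).symm
    · rw [Prod.snd_sum]
      refine (Finset.sum_eq_zero fun i _ => ?_).symm
      rw [Prod.smul_snd, addLine_bracket, smul_zero]

theorem IsMetric.addLine (hB : A.IsMetric B) {β : K} (hβ : β ≠ 0) :
    A.addLine.IsMetric (addLineForm B β) where
  nondegenerate x hx := by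
    refine Prod.ext (hB.nondegenerate _ fun y => ?_) ?_
    · simpa [addLineForm_apply] using hx (y, 0)
    · simpa [addLineForm_apply, hβ] using hx (0, 1)
  invariant a b c x y z hx hy hz := by
    simp only [addLine_ad, addLineForm_apply, hB.invariant a b c _ _ _ hx.fst hy.1 hz.1]
    simp
  supersymmetric a b x y hx hy := by
    rw [addLineForm_apply, addLineForm_apply, hB.supersymmetric a b _ _ hx.1 hy.1]
    obtain ⟨-, hx⟩ := hx
    obtain ⟨-, hy⟩ := hy
    rcases zmod_two_cases a with rfl | rfl
    · rw [zero_mul, superSign_zero]; ring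
    · have : x.2 = 0 := by simpa [lineGrade] using hx
      rw [this]; ring
  consistent a b x y hx hy hab := by
    rw [addLineForm_apply, hB.consistent a b _ _ hx.1 hy.1 hab]
    obtain ⟨-, hx⟩ := hx
    obtain ⟨-, hy⟩ := hy
    rcases zmod_two_cases a with rfl | rfl
    · have : y.2 = 0 := by simpa [lineGrade, hab.symm] using hy
      simp [this]
    · have : x.2 = 0 := by simpa [lineGrade] using hx
      simp [this]

theorem isIsometry_inl (β : K) :
    IsIsometry A B A.addLine (addLineForm B β) (LinearMap.inl K V K) :=
  ⟨LinearMap.inl_injective, fun _ _ hx => ⟨hx, Submodule.zero_mem _⟩, fun _ => rfl,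
    fun x y => by simp [addLineForm_apply]⟩

/-- If `I^⊥` exceeds `I` by an even anisotropic vector `e` with `[e, g, ..., g] ⊆ I`, the algebra is
isometric to a nondegenerate ideal of codimension `1` in a `T^*`-extension of `g / I`. -/
theorem IsMetric.exists_isometry_tstar_codim_one [FiniteDimensional K V] (h2 : (2 : K) ≠ 0)
    (hA : A.IsFirstClassNLie) (hB : A.IsMetric B) {I : Submodule K V} (hI : A.IsGradedIdeal I)
    {e : V} (he : e ∈ A.grade 0) (hee : B e e ≠ 0) (hperp : B.orthogonal I = I ⊔ K ∙ e)
    (hc : B.orthogonal I ≤ A.centralizerMod I) :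
    ∃ θ, (A.quotient I hI).IsSupercyclicCocycle θ ∧
      ((A.quotient I hI).tstar θ).IsFirstClassNLie ∧
      ((A.quotient I hI).tstar θ).IsMetric (A.quotient I hI).tstarForm ∧
      ∃ N : Submodule K ((V ⧸ I) × Dual K (V ⧸ I)),
        ((A.quotient I hI).tstar θ).IsGradedIdeal N ∧
        (∀ x ∈ N, (∀ y ∈ N, (A.quotient I hI).tstarForm x y = 0) → x = 0) ∧
        finrank K N + 1 = finrank K ((V ⧸ I) × Dual K (V ⧸ I)) ∧
        ∃ φ : V →ₗ[K] (V ⧸ I) × Dual K (V ⧸ I),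
          IsIsometry A B ((A.quotient I hI).tstar θ) (A.quotient I hI).tstarForm φ ∧
          LinearMap.range φ = N := by
  -- The kernel is `I + K (e, 1)`. The vector `(e, 1)` is isotropic because the form on the line is
  -- `-⟨e, e⟩`.
  let π : V × K →ₗ[K] V ⧸ I :=
    I.mkQ ∘ₗ (LinearMap.fst K V K - (LinearMap.snd K V K).smulRight e)
  have hπ : ∀ x, π x = I.mkQ (x.1 - x.2 • e) := fun _ => rfl
  have hπ0 : ∀ x, π x = 0 ↔ x.1 - x.2 • e ∈ I := by
    intro x
    rw [hπ, Submodule.mkQ_apply, Submodule.Quotient.mk_eq_zero]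
  have heI : e ∈ B.orthogonal I :=
    hperp ▸ Submodule.mem_sup_right (Submodule.mem_span_singleton_self e)
  have hπg : ∀ a, ∀ x ∈ A.addLine.grade a, π x ∈ (A.quotient I hI).grade a := by
    rintro a x ⟨hx1, hx2⟩
    refine Submodule.mem_map_of_mem (Submodule.sub_mem _ hx1 ?_)
    rcases zmod_two_cases a with rfl | rfl
    · exact Submodule.smul_mem _ _ he
    · have : x.2 = 0 := by simpa [lineGrade] using hx2
      rw [LinearMap.smulRight_apply, LinearMap.snd_apply, this, zero_smul]
      exact Submodule.zero_mem _
  have hπb : ∀ x : Fin (n + 1) → V × K,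
      π (A.addLine.bracket x) = (A.quotient I hI).bracket fun i => π (x i) := by
    intro x
    simp only [hπ]
    rw [A.quotient_bracket_mk hI fun i => (x i).1 - (x i).2 • e, ← sub_eq_zero, ← map_sub,
      addLine_bracket, zero_smul, sub_zero, Submodule.mkQ_apply, Submodule.Quotient.mk_eq_zero]
    -- Subtracting multiples of `e` from the entries does not change the bracket modulo `I`, since
    -- `[e, g, ..., g] ⊆ I`.
    refine multilinear_sub_mem A.bracket (U := A.centralizerMod I)
      (fun y i hy => mem_centralizerMod.1 hy y i rfl) _ _ fun i => ?_
    rw [sub_sub_cancel]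
    exact Submodule.smul_mem _ _ (hc heI)
  have hπs : Function.Surjective π := by
    intro q
    obtain ⟨v, rfl⟩ := I.mkQ_surjective q
    exact ⟨(v, 0), by simp [hπ]⟩
  have hII : ∀ u ∈ I, ∀ v ∈ I, B u v = 0 := fun u hu v hv =>
    (hperp ▸ Submodule.mem_sup_left hv : v ∈ B.orthogonal I) u hu
  have hIe : ∀ u ∈ I, B u e = 0 := fun u hu => heI u hu
  have heI' : ∀ u ∈ I, B e u = 0 := (hB.mem_orthogonal_iff hI.graded).1 heI
  have hL : (addLineForm B (B e e)).orthogonal (LinearMap.ker π) = LinearMap.ker π := by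
    ext x
    constructor
    · intro hx
      have h1 : x.1 ∈ B.orthogonal I := by
        intro u hu
        have : addLineForm B (B e e) (u, 0) x = 0 := hx _ ((hπ0 _).2 (by simpa using hu))
        simpa [addLineForm_apply] using this
      -- Orthogonality to `(I, 0)` puts `x.1` in `I ⊕ K e`; orthogonality to `(e, 1)` forces its
      -- coefficient at `e` to be `x.2`.
      have h3 : addLineForm B (B e e) (e, 1) x = 0 := hx _ ((hπ0 _).2 (by simp))
      rw [hperp] at h1
      obtain ⟨j, hj, u, hu, hju⟩ := Submodule.mem_sup.1 h1
      obtain ⟨c, rfl⟩ := Submodule.mem_span_singleton.1 hu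
      rw [addLineForm_apply, ← hju, map_add, heI' j hj, map_smul, smul_eq_mul] at h3
      have h4 : c = x.2 := by
        refine mul_left_cancel₀ hee ?_
        linear_combination h3
      rw [LinearMap.mem_ker, hπ0, ← hju, h4, add_sub_cancel_right]
      exact hj
    · intro hx y hy
      rw [LinearMap.mem_ker, hπ0] at hx hy
      change addLineForm B (B e e) y x = 0
      have h1 := hII _ hy _ hx
      have h3 := hIe _ hy
      have h4 := heI' _ hx
      simp only [map_sub, map_smul, LinearMap.sub_apply, LinearMap.smul_apply, smul_eq_mul]
        at h1 h3 h4
      rw [addLineForm_apply]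
      linear_combination h1 + x.2 * h3 + y.2 * h4
  obtain ⟨θ, hθ, hT, hM, φ, hφ, hφs⟩ := (hB.addLine hee).exists_isometry_tstar h2 hA.addLine
    hπg hπb hπs hL
  have hinl := isIsometry_inl (A := A) (B := B) (B e e)
  have hiso : IsIsometry A B ((A.quotient I hI).tstar θ) (A.quotient I hI).tstarForm
      (φ ∘ₗ LinearMap.inl K V K) :=
    ⟨hφ.injective.comp hinl.injective, fun a x hx => hφ.map_grade a _ (hinl.map_grade a x hx),
      fun x => by rw [LinearMap.comp_apply, hinl.map_bracket, hφ.map_bracket]; rfl,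
      fun x y => by rw [LinearMap.comp_apply, LinearMap.comp_apply, hφ.map_form, hinl.map_form]⟩
  refine ⟨θ, hθ, hT, hM, LinearMap.range (φ ∘ₗ LinearMap.inl K V K), ⟨?_, ?_⟩, ?_, ?_, _, hiso, rfl⟩
  · rintro _ ⟨v, rfl⟩ a
    exact ⟨A.proj a v, map_proj hiso.map_grade a v⟩
  · intro x i _
    -- The line is central and is not reached by brackets, so every bracket of the extension lies in
    -- the image of `V`.
    choose w hw using fun i => hφs (x i)
    refine ⟨A.bracket fun i => (w i).1, ?_⟩
    rw [← funext hw, ← hφ.map_bracket]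
    rfl
  · rintro _ ⟨v, rfl⟩ hv
    rw [hB.nondegenerate v fun y => by rw [← hiso.map_form]; exact hv _ ⟨y, rfl⟩, map_zero]
  · rw [LinearMap.finrank_range_of_inj hiso.injective,
      ← (LinearEquiv.ofBijective φ ⟨hφ.injective, hφs⟩).finrank_eq, finrank_prod, finrank_self]

end AddLine

end NSuperalgebra

/-! ### The theorem -/

theorem mainTheorem2 {K : Type*} [Field K] [IsAlgClosed K] (hK : ringChar K ≠ 2)
    {V : Type*} [AddCommGroup V] [Module K V] [FiniteDimensional K V]
    {n : ℕ} (hn : 2 ≤ n + 1)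
    (g : NSuperalgebra K V n) (hg : g.IsFirstClassNLie)
    (B : LinearMap.BilinForm K V) (hB : g.IsMetric B) (hnil : g.IsNilpotent)
    (J : Submodule K V) (hJ : g.IsGradedIdeal J) (hJB : NSuperalgebra.IsIsotropic B J) :
    ∃ (I : Submodule K V) (hI : g.IsGradedIdeal I),
      J ≤ I ∧
      Maximal (fun U => g.IsGradedIdeal U ∧ NSuperalgebra.IsIsotropic B U) I ∧
      Module.finrank K I = Module.finrank K V / 2 ∧
      (Even (Module.finrank K V) →
        ∃ θ, (g.quotient I hI).IsSupercyclicCocycle θ ∧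
          ((g.quotient I hI).tstar θ).IsFirstClassNLie ∧
          ((g.quotient I hI).tstar θ).IsMetric (g.quotient I hI).tstarForm ∧
          ∃ φ : V →ₗ[K] (V ⧸ I) × Module.Dual K (V ⧸ I),
            NSuperalgebra.IsIsometry g B ((g.quotient I hI).tstar θ)
              (g.quotient I hI).tstarForm φ ∧
            Function.Surjective φ) ∧
      (Odd (Module.finrank K V) →
        g.IsAbelian (B.orthogonal I) ∧
        ∃ θ, (g.quotient I hI).IsSupercyclicCocycle θ ∧
          ((g.quotient I hI).tstar θ).IsFirstClassNLie ∧
          ((g.quotient I hI).tstar θ).IsMetric (g.quotient I hI).tstarForm ∧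
          ∃ N : Submodule K ((V ⧸ I) × Module.Dual K (V ⧸ I)),
            ((g.quotient I hI).tstar θ).IsGradedIdeal N ∧
            (∀ x ∈ N, (∀ y ∈ N, (g.quotient I hI).tstarForm x y = 0) → x = 0) ∧
            Module.finrank K N + 1 =
              Module.finrank K ((V ⧸ I) × Module.Dual K (V ⧸ I)) ∧
            ∃ φ : V →ₗ[K] (V ⧸ I) × Module.Dual K (V ⧸ I),
              NSuperalgebra.IsIsometry g B ((g.quotient I hI).tstar θ)
                (g.quotient I hI).tstarForm φ ∧
              LinearMap.range φ = N) := by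
  have h2 : (2 : K) ≠ 0 := Ring.two_ne_zero hK
  -- Finite dimension provides the ascending chain condition on subspaces.
  obtain ⟨I, hJI, hI⟩ := exists_maximal_ge_of_wellFoundedGT
    (fun U => g.IsGradedIdeal U ∧ NSuperalgebra.IsIsotropic B U) J ⟨hJ, hJB⟩
  have hid : g.IsGradedIdeal I := hI.prop.1
  have hc := hB.orthogonal_le_centralizerMod hg hnil hI
  refine ⟨I, hid, hJI, hI, ?_⟩
  -- The two shapes of `I^⊥` give `dim V = 2 dim I` and `dim V = 2 dim I + 1`, so the parity of `dim
  -- V` decides between them.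
  rcases hB.orthogonal_of_maximal h2 hg hnil hI with ⟨hperp, hfr⟩ | ⟨e, he, hee, hperp, hfr⟩
  · refine ⟨by omega, fun _ => ?_, fun hodd => ?_⟩
    · refine hB.exists_isometry_tstar h2 hg (π := I.mkQ)
        (fun a x hx => Submodule.mem_map_of_mem hx)
        (fun x => (g.quotient_bracket_mk hid x).symm) I.mkQ_surjective ?_
      rw [Submodule.ker_mkQ, hperp]
    · rw [← Nat.not_even_iff_odd, hfr] at hodd
      exact absurd (even_two_mul _) hodd
  · refine ⟨by omega, fun heven => ?_, fun _ => ⟨hB.isAbelian_orthogonal hg hid hc, ?_⟩⟩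
    · rw [← Nat.not_odd_iff_even, hfr] at heven
      exact absurd (odd_two_mul_add_one _) heven
    · exact hB.exists_isometry_tstar_codim_one h2 hg hid he hee hperp hc
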